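/- \textbf{Setting.} Let $I,N\ge 1$ be integers. All matrices act on column vectors: for an operator $A$ on $\mathbb{C}^{m}$, $A_a^d$ is the coefficient of $\mathrm e_d$ in $A\mathrm e_a$; for an operator $A$ on $\mathbb{C}^m\otimes\mathbb{C}^m$, $A_{a,b}^{c,d}$ is the coefficient of $\mathrm e_c\otimes \mathrm e_d$ in $A(\mathrm e_a\otimes \mathrm e_b)$. Let $q,\kappa,a,b,c,d$ be real numbers with $$0<q<1,\quad 0<\kappa<q^{\frac{I-1}{2}},\quad a,b,c,d>0,\quad a-c>q^{\frac{1-I}{2}}/\kappa,\quad b-d>q^{\frac{1-I}{2}}/\kappa .$$ \textbf{Fused matrices.} In the bases $\mathrm e_0\otimes \mathrm e_0,\mathrm e_0\otimes \mathrm e_1,\mathrm e_1\otimes \mathrm e_0,\mathrm e_1\otimes \mathrm e_1$ of $\mathbb{C}^2\otimes\mathbb{C}^2$ and $\mathrm e_0,\mathrm e_1$ of $\mathbb{C}^2$ let $$\mathsf R(u)=\begin{bmatrix}1&0&0&0\\0&\frac{q(1-u)}{1-qu}&\frac{u(1-q)}{1-qu}&0\\0&\frac{1-q}{1-qu}&\frac{1-u}{1-qu}&0\\0&0&0&1\end{bmatrix},$$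 $$\mathsf K(u)=\frac{1}{cu^2+u-a}\begin{bmatrix}(c-a)u^2+u&c(u^2-1)\\a(u^2-1)&c-a+u\end{bmatrix},\qquad \overline{\mathsf K}(u)=\frac{1}{bu^2-u-d}\begin{bmatrix}(b-d)u^2-u&b(u^2-1)\\d(u^2-1)&b-d-u\end{bmatrix}.$$ Subscripts indicate the tensor factors on which these act. Define $\Pi:(\mathbb{C}^2)^{\otimes I}\to\mathbb{C}^{I+1}$ by $\Pi(\mathrm e_{z_1}\otimes\dots\otimes \mathrm e_{z_I})=\mathrm e_{z_1+\dots+z_I}$, and $\widehat\Pi:\mathbb{C}^{I+1}\to(\mathbb{C}^2)^{\otimes I}$ by $\widehat\Pi(\mathrm e_j)=Z_j^{-1}\sum_{z\in\{0,1\}^I,\,z_1+\dots+z_I=j}q^{\mathrm{inv}(z)}\mathrm e_{z_1}\otimes\dots\otimes \mathrm e_{z_I}$, where $\mathrm{inv}(z)=\#\{i<k:z_i>z_k\}$ and $Z_j=\sum_{z\in\{0,1\}^I,\,z_1+\dots+z_I=j}q^{\mathrm{inv}(z)}$. Let $P_{\mathrm{rev}}$ reverse the order of the $I$ tensor factors of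 $(\mathbb{C}^2)^{\otimes I}$. Write $\prod^{\rightarrow}$ (resp. $\prod^{\leftarrow}$) for products written from left to right in increasing (resp. decreasing) order of the index; in a double product the inner product is carried out first, inside each factor of the outer one. Let $$\mathsf R^I(u)=(\Pi\otimes\Pi)\Bigl(\prod_{i=1}^{I}{}^{\leftarrow}\prod_{j=1}^{I}{}^{\rightarrow}\mathsf R_{j,i+I}(uq^{j-i})\Bigr)(\widehat\Pi\otimes\widehat\Pi),$$ $$\mathsf K^I(u)=\Pi P_{\mathrm{rev}}\Bigl(\prod_{i=1}^{I}{}^{\leftarrow}\mathsf K_i(uq^{\frac{I+1}2-i})\prod_{j=1}^{i-1}{}^{\leftarrow}\mathsf R_{j,i}(u^2q^{I+1-i-j})\Bigr)\widehat\Pi,$$ $$\overline{\mathsf K}^I(u)=\Pi P_{\mathrm{rev}}\Bigl(\prod_{i=1}^{I}{}^{\rightarrow}\overline{\mathsf K}_i(uq^{\frac{I+1}2-i})\prod_{j=i+1}^{I}{}^{\rightarrow}\mathsf R^{-1}_{j,i}(u^2q^{I+1-i-j})\Bigr)\widehat\Pi .$$ \textbf{Fused vertex model on a strip.} The vertices of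 the strip are the $(x,y)\in\mathbb{Z}^2$ with $0\le y\le x\le y+N$; those with $x=y$ (resp. $x=y+N$) are left (resp. right) boundary vertices, the others are bulk vertices. Each edge carries between $0$ and $I$ arrows. For $i,j,k,l\in\{0,\dots,I\}$ a bulk vertex entered by $i$ arrows from below and $j$ from the left emits $k$ arrows upwards and $l$ to the right with probability $\mathrm R_{i,j}^{k,l}=\mathsf R^I(\kappa^2)_{j,i}^{l,k}$; a left boundary vertex entered by $i$ arrows from below emits $l$ to the right with probability ${}_\ell\mathrm K_i^l=\mathsf K^I(\kappa)_i^l$; a right boundary vertex entered by $j$ arrows from the left emits $k$ upwards with probability ${}_r\mathrm K_j^k=\overline{\mathsf K}^I(1/\kappa)_j^k$. A down-right path $\mathcal P$ goes from a left to a right boundary vertex by unit steps to the right or downwards. It has $N$ outgoing edges $p_1,\dots,p_N\in\{\uparrow,\rightarrow\}$, labelled from its up-left to its down-right end: a step to the right gives the edge $\uparrow$ leaving its end point, a step downwards gives the edge $\rightarrow$ leaving its starting point. Starting from occupation numbers $\tau\in\{0,\dots,I\}^N$ of the outgoing edges of $\mathcal P$, sample successively the vertices above $\mathcal P$ and on or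 below the translate $\mathcal P+(1,1)$ (by increasing $y$ and, for equal $y$, by increasing $x$). The probability that the outgoing edges of $\mathcal P+(1,1)$ get occupation numbers $\tau'$ defines the transition matrix $T_{\mathcal P}(\tau,\tau')$ of a Markov chain on $\{0,\dots,I\}^N$. The stationary measure of the model on $\mathcal P$ is the stationary probability measure of this chain. \textbf{Matrix product state.} Let $\mathcal A$ be a unital associative $\mathbb{C}$-algebra represented on a complex vector space $H$, and let $\mathbf d,\mathbf e\in\mathcal A$, $\langle W|\in H^*$, $|V\rangle\in H$ satisfy $$\mathbf d\mathbf e-q\mathbf e\mathbf d=1-q,\qquad \langle W|(a\mathbf e-c\mathbf d+1)=0,\qquad (b\mathbf d-d\,\mathbf e+1)|V\rangle=0,$$ where $d$ denotes the real parameter and $\mathbf d$ the algebra element. Put $\mathsf M_0(u)=u+\mathbf e$, $\mathsf M_1(u)=\frac1u+\mathbf d$ and, for $0\le\zeta\le I$, $$\mathsf M^I_\zeta(u)=\sum_{\substack{\zeta_1,\dots,\zeta_I\in\{0,1\}\\ \zeta_1+\dots+\zeta_I=\zeta}}\ \prod_{i=1}^{I}{}^{\rightarrow}\ \mathsf M_{\zeta_i}\bigl(uq^{-\frac{I+1}2+i}\bigr),\qquad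 M_j^{\uparrow}=\mathsf M_j^I(1/\kappa),\quad M_j^{\rightarrow}=\mathsf M_j^I(\kappa).$$ \textbf{Theorem.} The vertex weights $\mathrm R$, ${}_\ell\mathrm K$, ${}_r\mathrm K$ are nonnegative, satisfy $\sum_{k,l}\mathrm R_{i,j}^{k,l}=\sum_l{}_\ell\mathrm K_i^l=\sum_k{}_r\mathrm K_j^k=1$, and $\mathrm R_{i,j}^{k,l}=0$ unless $i+j=k+l$. For every down-right path $\mathcal P$ with outgoing edges $p_1,\dots,p_N$, $T_{\mathcal P}$ is a stochastic matrix; if the denominator below is nonzero, then the chain has a stationary probability measure $\mu_{\mathcal P}$, it is unique, and for all $\tau\in\{0,\dots,I\}^N$ $$\mu_{\mathcal P}(\tau_1,\dots,\tau_N)=\frac{\langle W|M_{\tau_1}^{p_1}\times\dots\times M_{\tau_N}^{p_N}|V\rangle}{\langle W|\bigl(\sum_{j=0}^I M_j^{p_1}\bigr)\times\dots\times\bigl(\sum_{j=0}^I M_j^{p_N}\bigr)|V\rangle}.$$ -/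

import Mathlib

open Matrix
open scoped Kronecker

/-! ### Fusion: operators on tensor powers of `ℂ²`, written in the standard basis

The basis vectors of `(ℂ²)^{⊗ ι}` are indexed by `ι → Fin 2`.  An operator `A` is written as the
matrix whose entry `A out inp` is the coefficient of the basis vector `out` in the image of the
basis vector `inp`.  All parameters and spectral parameters at which the operators are used are
real, so the matrices have real entries. -/

noncomputable section

namespace FusedVertex

/-- The unfused matrix `R(u)` on `ℂ² ⊗ ℂ²`, in the basis `e₀⊗e₀, e₀⊗e₁, e₁⊗e₀, e₁⊗e₁`. -/
def unfusedR (q u : ℝ) : Matrix (Fin 2 × Fin 2) (Fin 2 × Fin 2) ℝ :=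
  let m : Matrix (Fin 4) (Fin 4) ℝ :=
    !![1, 0, 0, 0;
       0, q * (1 - u) / (1 - q * u), u * (1 - q) / (1 - q * u), 0;
       0, (1 - q) / (1 - q * u), (1 - u) / (1 - q * u), 0;
       0, 0, 0, 1]
  m.submatrix (finProdFinEquiv (m := 2) (n := 2)) (finProdFinEquiv (m := 2) (n := 2))

/-- The unfused matrix `K(u)` on `ℂ²`. -/
def unfusedK (a c u : ℝ) : Matrix (Fin 2) (Fin 2) ℝ :=
  !![((c - a) * u ^ 2 + u) / (c * u ^ 2 + u - a), c * (u ^ 2 - 1) / (c * u ^ 2 + u - a);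
     a * (u ^ 2 - 1) / (c * u ^ 2 + u - a), (c - a + u) / (c * u ^ 2 + u - a)]

/-- The unfused matrix `K̄(u)` on `ℂ²`. -/
def unfusedKbar (b d u : ℝ) : Matrix (Fin 2) (Fin 2) ℝ :=
  !![((b - d) * u ^ 2 - u) / (b * u ^ 2 - u - d), b * (u ^ 2 - 1) / (b * u ^ 2 - u - d);
     d * (u ^ 2 - 1) / (b * u ^ 2 - u - d), (b - d - u) / (b * u ^ 2 - u - d)]

/-- The operator `A` on `ℂ²` acting on the `i`-th tensor factor. -/
def actOne {ι : Type*} [Fintype ι] [DecidableEq ι] (A : Matrix (Fin 2) (Fin 2) ℝ) (i : ι) :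
    Matrix (ι → Fin 2) (ι → Fin 2) ℝ :=
  Matrix.of fun out inp => if ∀ k, k ≠ i → out k = inp k then A (out i) (inp i) else 0

/-- The operator `A` on `ℂ² ⊗ ℂ²` acting on the `i`-th and `j`-th tensor factors (its first factor
acts at `i`, its second one at `j`), for `i ≠ j`. -/
def actTwo {ι : Type*} [Fintype ι] [DecidableEq ι]
    (A : Matrix (Fin 2 × Fin 2) (Fin 2 × Fin 2) ℝ) (i j : ι) :
    Matrix (ι → Fin 2) (ι → Fin 2) ℝ :=
  Matrix.of fun out inp =>
    if ∀ k, k ≠ i → k ≠ j → out k = inp k then A (out i, out j) (inp i, inp j) else 0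

/-- The permutation operator that reverses the order of the `I` tensor factors. -/
def reversal (I : ℕ) : Matrix (Fin I → Fin 2) (Fin I → Fin 2) ℝ :=
  Matrix.of fun out inp => if out = inp ∘ Fin.rev then 1 else 0

/-- The total number of ones of a word in `{0,1}`. -/
def total {I : ℕ} (z : Fin I → Fin 2) : ℕ := ∑ i, (z i : ℕ)

/-- The number of inversions `i < j`, `z i > z j`. -/
def inversions {I : ℕ} (z : Fin I → Fin 2) : ℕ :=
  (Finset.univ.filter fun p : Fin I × Fin I => p.1 < p.2 ∧ z p.2 < z p.1).card

/-- The normalization `Z_q(I; j)`, the sum of `q^inv` over the words with total `j`. -/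
def partitionZ (I : ℕ) (q : ℝ) (j : ℕ) : ℝ :=
  ∑ z : Fin I → Fin 2, if total z = j then q ^ inversions z else 0

/-- The surjection `Π : (ℂ²)^{⊗I} → ℂ^{I+1}`. -/
def proj (I : ℕ) : Matrix (Fin (I + 1)) (Fin I → Fin 2) ℝ :=
  Matrix.of fun j z => if total z = j then 1 else 0

/-- The injection `Π̂ : ℂ^{I+1} → (ℂ²)^{⊗I}` onto the `q`-exchangeable subspace. -/
def incl (I : ℕ) (q : ℝ) : Matrix (Fin I → Fin 2) (Fin (I + 1)) ℝ :=
  Matrix.of fun z j => if total z = j then q ^ inversions z / partitionZ I q j else 0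

/-- The one-based value of an index in `[[1, I]]`, as a real number. -/
def idx {I : ℕ} (a : Fin I) : ℝ := (a : ℝ) + 1

/-- The product of `f a` over `a ∈ [[1, I]]`, from left to right in increasing order of `a`. -/
def prodInc {α : Type*} [Monoid α] {I : ℕ} (f : Fin I → α) : α :=
  ((List.finRange I).map f).prod

/-- The product of `f a` over `a ∈ [[1, I]]`, from left to right in decreasing order of `a`. -/
def prodDec {α : Type*} [Monoid α] {I : ℕ} (f : Fin I → α) : α :=
  ((List.finRange I).reverse.map f).prod

/-- The operator on `(ℂ²)^{⊗I} ⊗ (ℂ²)^{⊗I}` from which the fused `R` matrix is obtained. The index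
`Sum.inl b` is the `b`-th factor, the index `Sum.inr a` is the `(a+I)`-th factor. -/
def fusionOpR (I : ℕ) (q u : ℝ) : Matrix (Fin I ⊕ Fin I → Fin 2) (Fin I ⊕ Fin I → Fin 2) ℝ :=
  prodDec fun a : Fin I => prodInc fun b : Fin I =>
    actTwo (unfusedR q (u * q ^ (idx b - idx a))) (Sum.inl b) (Sum.inr a)

/-- The operator on `(ℂ²)^{⊗I}` from which the fused `K` matrix is obtained. -/
def fusionOpK (I : ℕ) (q a c u : ℝ) : Matrix (Fin I → Fin 2) (Fin I → Fin 2) ℝ :=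
  reversal I * prodDec fun i : Fin I =>
    actOne (unfusedK a c (u * q ^ (((I : ℝ) + 1) / 2 - idx i))) i *
      prodDec fun j : Fin I =>
        if j < i then
          actTwo (unfusedR q (u ^ 2 * q ^ ((I : ℝ) + 1 - idx i - idx j))) j i
        else 1

/-- The operator on `(ℂ²)^{⊗I}` from which the fused `K̄` matrix is obtained. -/
def fusionOpKbar (I : ℕ) (q b d u : ℝ) : Matrix (Fin I → Fin 2) (Fin I → Fin 2) ℝ :=
  reversal I * prodInc fun i : Fin I =>
    actOne (unfusedKbar b d (u * q ^ (((I : ℝ) + 1) / 2 - idx i))) i *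
      prodInc fun j : Fin I =>
        if i < j then
          actTwo (unfusedR q (u ^ 2 * q ^ ((I : ℝ) + 1 - idx i - idx j)))⁻¹ j i
        else 1

/-- The fused matrix `R^I(u)` on `ℂ^{I+1} ⊗ ℂ^{I+1}`. -/
def fusedR (I : ℕ) (q u : ℝ) :
    Matrix (Fin (I + 1) × Fin (I + 1)) (Fin (I + 1) × Fin (I + 1)) ℝ :=
  (proj I ⊗ₖ proj I) *
    Matrix.reindex (Equiv.sumArrowEquivProdArrow (Fin I) (Fin I) (Fin 2))
      (Equiv.sumArrowEquivProdArrow (Fin I) (Fin I) (Fin 2)) (fusionOpR I q u) *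
    (incl I q ⊗ₖ incl I q)

/-- The fused matrix `K^I(u)` on `ℂ^{I+1}`. -/
def fusedK (I : ℕ) (q a c u : ℝ) : Matrix (Fin (I + 1)) (Fin (I + 1)) ℝ :=
  proj I * fusionOpK I q a c u * incl I q

/-- The fused matrix `K̄^I(u)` on `ℂ^{I+1}`. -/
def fusedKbar (I : ℕ) (q b d u : ℝ) : Matrix (Fin (I + 1)) (Fin (I + 1)) ℝ :=
  proj I * fusionOpKbar I q b d u * incl I q

/-! ### Higher spin vertex models on the strip `{(x, y) : 0 ≤ y ≤ x ≤ y + N}` -/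

/-- Vertex weights: `R a b c d` is `R_{a,b}^{c,d}` (`a` arrows enter from below, `b` from the left,
`c` exit upwards, `d` exit to the right); `Kl a d` is the weight of a left boundary vertex which `a`
arrows enter from below and `d` exit to the right; `Kr b c` is the weight of a right boundary vertex
which `b` arrows enter from the left and `c` exit upwards. -/
structure VertexWeights (I : ℕ) where
  R : Fin (I + 1) → Fin (I + 1) → Fin (I + 1) → Fin (I + 1) → ℝ
  Kl : Fin (I + 1) → Fin (I + 1) → ℝ
  Kr : Fin (I + 1) → Fin (I + 1) → ℝ

/-- The weights are stochastic, and arrows are conserved in the bulk. -/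
structure VertexWeights.IsStochastic {I : ℕ} (w : VertexWeights I) : Prop where
  R_nonneg : ∀ a b c d, 0 ≤ w.R a b c d
  Kl_nonneg : ∀ a d, 0 ≤ w.Kl a d
  Kr_nonneg : ∀ b c, 0 ≤ w.Kr b c
  R_sum : ∀ a b, ∑ c, ∑ d, w.R a b c d = 1
  Kl_sum : ∀ a, ∑ d, w.Kl a d = 1
  Kr_sum : ∀ b, ∑ c, w.Kr b c = 1
  R_conserve : ∀ a b c d : Fin (I + 1), (a : ℕ) + b ≠ c + d → w.R a b c d = 0

/-- Directions of edges: `up` for `↑` (vertical), `right` for `→` (horizontal). -/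
inductive Dir
  | up
  | right
  deriving DecidableEq

/-- The edge `((x, y), Dir.up)` is the vertical edge that enters the vertex `(x, y)` from below, and
`((x, y), Dir.right)` is the horizontal edge that enters `(x, y)` from the left. -/
abbrev Edge : Type := (ℕ × ℕ) × Dir

/-- A down-right path on the strip of width `N`, as the sequence of its vertices: it starts at a left
boundary vertex, each step goes right by one or down by one, and it ends at a right boundary
vertex. -/
structure DownRightPath (N : ℕ) where
  vert : Fin (N + 1) → ℕ × ℕ
  left_boundary : (vert 0).1 = (vert 0).2
  step : ∀ i : Fin N,
    ((vert i.succ).1 = (vert i.castSucc).1 + 1 ∧ (vert i.succ).2 = (vert i.castSucc).2) ∨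
      ((vert i.succ).1 = (vert i.castSucc).1 ∧ (vert i.succ).2 + 1 = (vert i.castSucc).2)
  right_boundary : (vert (Fin.last N)).1 = (vert (Fin.last N)).2 + N

namespace DownRightPath

variable {N : ℕ}

/-- The direction `p_i` of the `i`-th outgoing edge, counted from the up-left start of the path: a
step to the right has an outgoing edge `↑` (from the end of the step), a step downwards has an
outgoing edge `→` (from the start of the step). -/
def dir (P : DownRightPath N) (i : Fin N) : Dir :=
  if (P.vert i.succ).2 = (P.vert i.castSucc).2 then Dir.up else Dir.right

/-- The `i`-th outgoing edge of the path. -/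
def outEdge (P : DownRightPath N) (i : Fin N) : Edge :=
  match P.dir i with
  | Dir.up => (((P.vert i.succ).1, (P.vert i.succ).2 + 1), Dir.up)
  | Dir.right => (((P.vert i.castSucc).1 + 1, (P.vert i.castSucc).2), Dir.right)

/-- The translation `Υ₁` of the path by `(1, 1)`. -/
def shift (P : DownRightPath N) : DownRightPath N where
  vert k := ((P.vert k).1 + 1, (P.vert k).2 + 1)
  left_boundary := by simpa using P.left_boundary
  step i := by have := P.step i; simp only; omega
  right_boundary := by have := P.right_boundary; simp only; omega

/-- The vertices between `P` and `Q`, including those on `Q` and excluding those on `P`, listed by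
increasing `y` and, for equal `y`, by increasing `x`. The `k`-th vertex of a down-right path is its
only vertex on the diagonal `x - y = k`, so that `(y + k, y)` lies above `P` exactly if
`y > (P.vert k).2`, and on or below `Q` exactly if `y ≤ (Q.vert k).2`. -/
def between (P Q : DownRightPath N) : List (ℕ × ℕ) :=
  (List.range ((Q.vert 0).2 + 1)).flatMap fun y =>
    ((List.finRange (N + 1)).filter
      fun k => decide ((P.vert k).2 < y ∧ y ≤ (Q.vert k).2)).map fun k => (y + (k : ℕ), y)

end DownRightPath

/-- The expected value of `f` at the final configuration when the outgoing edges of the vertices in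
the list are sampled one vertex after the other, starting from the configuration `η`. -/
def sampleExp {I : ℕ} (w : VertexWeights I) (N : ℕ) :
    List (ℕ × ℕ) → ((Edge → Fin (I + 1)) → ℝ) → (Edge → Fin (I + 1)) → ℝ
  | [], f, η => f η
  | (x, y) :: vs, f, η =>
    if x = y then
      ∑ d, w.Kl (η ((x, y), Dir.up)) d *
        sampleExp w N vs f (Function.update η ((x + 1, y), Dir.right) d)
    else if x = y + N then
      ∑ c, w.Kr (η ((x, y), Dir.right)) c *
        sampleExp w N vs f (Function.update η ((x, y + 1), Dir.up) c)
    else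
      ∑ c, ∑ d, w.R (η ((x, y), Dir.up)) (η ((x, y), Dir.right)) c d *
        sampleExp w N vs f
          (Function.update (Function.update η ((x, y + 1), Dir.up) c) ((x + 1, y), Dir.right) d)

open Classical in
/-- The transition probabilities `P_{P,Q}(τ, τ')`: start with the outgoing configuration `τ` of `P`,
sample through all vertices between `P` and `Q`, and take the probability that the outgoing
configuration of `Q` is `τ'`. (No edge other than the outgoing edges of `P` is read before it has
been sampled, so its initial value `0` is irrelevant.) -/
def transition {I N : ℕ} (w : VertexWeights I) (P Q : DownRightPath N) :
    Matrix (Fin N → Fin (I + 1)) (Fin N → Fin (I + 1)) ℝ :=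
  Matrix.of fun τ τ' =>
    sampleExp w N (P.between Q) (fun η => if ∀ i, η (Q.outEdge i) = τ' i then 1 else 0)
      (Function.extend P.outEdge τ fun _ => 0)

/-- `μ` is a stationary probability measure of the Markov chain with transition matrix `T`. -/
structure IsStationaryMeasure {S : Type*} [Fintype S] (T : Matrix S S ℝ) (μ : S → ℝ) : Prop where
  nonneg : ∀ s, 0 ≤ μ s
  sum_eq_one : ∑ s, μ s = 1
  stationary : ∀ s', ∑ s, T s s' * μ s = μ s'

/-- The vertex weights of the fused vertex model on a strip. -/
def fusedWeights (I : ℕ) (q κ a b c d : ℝ) : VertexWeights I where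
  R i j k l := fusedR I q (κ ^ 2) (l, k) (j, i)
  Kl i l := fusedK I q a c κ l i
  Kr j k := fusedKbar I q b d (1 / κ) k j

/-! ### The fused matrix product ansatz -/

section MatrixProduct

variable {A : Type*} [Ring A] [Algebra ℂ A]

/-- `M_0(u) = u + e` and `M_1(u) = 1/u + d`. -/
def unfusedM (dOp eOp : A) (z : Fin 2) (u : ℂ) : A :=
  if z = 0 then algebraMap ℂ A u + eOp else algebraMap ℂ A (1 / u) + dOp

/-- The fused elements `M^I_ζ(u)`. -/
def fusedM (I : ℕ) (q : ℝ) (dOp eOp : A) (ζ : Fin (I + 1)) (u : ℂ) : A :=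
  ∑ z : Fin I → Fin 2,
    if total z = ζ then
      prodInc fun i : Fin I =>
        unfusedM dOp eOp (z i) (u * ((q ^ (-((I : ℝ) + 1) / 2 + idx i) : ℝ) : ℂ))
    else 0

/-- `M_j^↑ = M^I_j(1/κ)` and `M_j^→ = M^I_j(κ)`. -/
def ansatzM (I : ℕ) (q κ : ℝ) (dOp eOp : A) (p : Dir) (j : Fin (I + 1)) : A :=
  match p with
  | Dir.up => fusedM I q dOp eOp j (1 / (κ : ℂ))
  | Dir.right => fusedM I q dOp eOp j (κ : ℂ)

variable {H : Type*} [AddCommGroup H] [Module ℂ H]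

/-- The numerator `⟨W| M_{τ_1}^{p_1} × ⋯ × M_{τ_N}^{p_N} |V⟩` of the matrix product state. -/
def mpsNumerator {I N : ℕ} (M : Dir → Fin (I + 1) → A) (ρ : A →ₐ[ℂ] Module.End ℂ H)
    (W : Module.Dual ℂ H) (V : H) (p : Fin N → Dir) (τ : Fin N → Fin (I + 1)) : ℂ :=
  W (ρ (prodInc fun i => M (p i) (τ i)) V)

/-- The denominator `⟨W| (∑_j M_j^{p_1}) × ⋯ × (∑_j M_j^{p_N}) |V⟩` of the matrix product state. -/
def mpsDenominator {I N : ℕ} (M : Dir → Fin (I + 1) → A) (ρ : A →ₐ[ℂ] Module.End ℂ H)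
    (W : Module.Dual ℂ H) (V : H) (p : Fin N → Dir) : ℂ :=
  W (ρ (prodInc fun i => ∑ j, M (p i) j) V)

end MatrixProduct

end FusedVertex

end

/-! Stationarity is a transport property. To each down-right path belongs the vector `τ ↦ ⟨W|
M_{τ_1}^{p_1} ⋯ M_{τ_N}^{p_N} |V⟩`. Sampling one vertex raises the path at one diagonal and acts on
this vector by an operator on one or two sites (`moveMat`). The relations in `IsAnsatz` say that the
bulk weight turns `M^→ M^↑` into `M^↑ M^→`, the left weight turns `M^↑` into `M^→` next to `⟨W|`,
and the right weight turns `M^→` into `M^↑` next to `|V⟩`. So the vector of a path is carried to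
that of the raised path (`act_moveMat_mpsVector`). Once every diagonal has been raised, the
directions are the original ones and the vector has returned to itself (`transition_mpsVector`).

The fused relations come from the unfused ones, which are computations with `de - q ed = 1 - q`
(`letter_exchange`, `letter_left_boundary`, `letter_right_boundary`). A fused letter is the image
under `Π` of a word of unfused letters whose parameters form a geometric progression of ratio `q`.
Such a word is `q`-exchangeable: it is `q ^ inv` times an element that depends on the total only
(`prod_letter_eq_sortedWord`). Hence `Π̂` recovers the word from the fused letter
(`fusedWord_exchangeable`), and the operator between `Π` and `Π̂` can be applied factor by factor:
each `R` exchanges two adjacent letters, each `K` or `K̄` inverts the parameter of a letter at an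
end of the word.

In the given range of parameters all factors are stochastic, arrows can go straight on in the bulk,
and they can be absorbed at the boundaries. The empty configuration is therefore accessible from
everywhere (`exists_transition_pos`), which forces each real invariant vector to have constant sign
(`nonneg_of_stationary`). Thus no nonzero invariant vector has sum zero. Applied to the imaginary
part of the normalized matrix product vector and to the difference of two stationary measures, this
gives existence, reality and uniqueness (`exists_unique_stationary`). -/

noncomputable section

namespace FusedVertex

/-! ### Matrices acting on vectors with values in a module -/

section Act

variable {m n l E F : Type*} [Fintype n] [Fintype l] [AddCommGroup E] [Module ℝ E]
  [AddCommGroup F] [Module ℝ F]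

/-- The action of a real matrix on a vector with entries in a real vector space. -/
def act (B : Matrix m n ℝ) (v : n → E) : m → E := fun o => ∑ i, B o i • v i

theorem act_mul (B : Matrix m n ℝ) (C : Matrix n l ℝ) (v : l → E) :
    act (B * C) v = act B (act C v) := by
  funext o
  simp only [act, Matrix.mul_apply, Finset.sum_smul, Finset.smul_sum, mul_smul]
  exact Finset.sum_comm

theorem act_one [DecidableEq n] (v : n → E) : act (1 : Matrix n n ℝ) v = v := by
  funext o
  simp [act, Matrix.one_apply, ite_smul]

theorem act_comp (B : Matrix m n ℝ) (φ : E →ₗ[ℝ] F) (v : n → E) :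
    act B (fun i => φ (v i)) = fun o => φ (act B v o) := by
  funext o
  simp [act]

end Act

/-! ### Words in an algebra, with letters attached to sites -/

section Word

variable {ι S X A : Type*} [Ring A]

/-- The product of the letters `M x (z s)` over the list of pairs `(s, x)`. -/
def word (M : X → S → A) (L : List (ι × X)) (z : ι → S) : A :=
  (L.map fun p => M p.2 (z p.1)).prod

theorem word_nil (M : X → S → A) (z : ι → S) : word M [] z = 1 := rfl

theorem word_cons (M : X → S → A) (p : ι × X) (L : List (ι × X)) (z : ι → S) :
    word M (p :: L) z = M p.2 (z p.1) * word M L z := by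
  simp [word]

theorem word_append (M : X → S → A) (L L' : List (ι × X)) (z : ι → S) :
    word M (L ++ L') z = word M L z * word M L' z := by
  simp [word]

theorem word_update [DecidableEq ι] (M : X → S → A) {L : List (ι × X)} {s : ι} (hs : s ∉ L.map Prod.fst)
    (z : ι → S) (a : S) : word M L (Function.update z s a) = word M L z := by
  unfold word
  congr 1
  refine List.map_congr_left fun p hp => ?_
  have : p.1 ≠ s := fun h => hs (List.mem_map.2 ⟨p, hp, h⟩)
  simp [this]

end Word

/-! ### Operators acting on one or two sites -/

section LocalOperators

variable {ι S : Type*} [Fintype ι] [DecidableEq ι] [Fintype S] [DecidableEq S]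

/-- The operator `B` acting at the site `s`. -/
def localOne (B : Matrix S S ℝ) (s : ι) : Matrix (ι → S) (ι → S) ℝ :=
  Matrix.of fun out inp => if ∀ k, k ≠ s → out k = inp k then B (out s) (inp s) else 0

/-- The operator `B` acting at the sites `s` and `t`. -/
def localTwo (B : Matrix (S × S) (S × S) ℝ) (s t : ι) : Matrix (ι → S) (ι → S) ℝ :=
  Matrix.of fun out inp =>
    if ∀ k, k ≠ s → k ≠ t → out k = inp k then B (out s, out t) (inp s, inp t) else 0

/-- A general alphabet `S` serves twice: two letters in the fusion, `I + 1` letters for the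
occupation numbers on the strip. -/
theorem actOne_eq_localOne (B : Matrix (Fin 2) (Fin 2) ℝ) (s : ι) : actOne B s = localOne B s := rfl

theorem actTwo_eq_localTwo (B : Matrix (Fin 2 × Fin 2) (Fin 2 × Fin 2) ℝ) (s t : ι) :
    actTwo B s t = localTwo B s t := rfl

theorem sum_agree_off_one {E : Type*} [AddCommMonoid E] (s : ι) (z : ι → S) (F : (ι → S) → E) :
    (∑ w : ι → S, if ∀ k, k ≠ s → z k = w k then F w else 0) =
      ∑ p : S, F (Function.update z s p) := by
  rw [← Finset.sum_filter]
  symm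
  refine Finset.sum_nbij' (fun p => Function.update z s p) (fun w => w s) ?_ ?_ ?_ ?_ ?_
  · intro p _
    simp only [Finset.mem_filter, Finset.mem_univ, true_and]
    intro k hk
    simp [hk]
  · simp
  · simp
  · intro w hw
    simp only [Finset.mem_filter, Finset.mem_univ, true_and] at hw
    funext k
    by_cases hk : k = s
    · subst hk; simp
    · simp [hk, hw k hk]
  · simp

theorem sum_agree_off_two {E : Type*} [AddCommMonoid E] {s t : ι} (hst : s ≠ t) (z : ι → S)
    (F : (ι → S) → E) :
    (∑ w : ι → S, if ∀ k, k ≠ s → k ≠ t → z k = w k then F w else 0) =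
      ∑ p : S × S, F (Function.update (Function.update z s p.1) t p.2) := by
  rw [← Finset.sum_filter]
  symm
  refine Finset.sum_nbij' (fun p => Function.update (Function.update z s p.1) t p.2)
    (fun w => (w s, w t)) ?_ ?_ ?_ ?_ ?_
  · intro p _
    simp only [Finset.mem_filter, Finset.mem_univ, true_and]
    intro k hk hk'
    simp [hk, hk']
  · simp
  · rintro ⟨p, p'⟩ _
    simp [hst]
  · intro w hw
    simp only [Finset.mem_filter, Finset.mem_univ, true_and] at hw
    funext k
    by_cases hk' : k = t
    · subst hk'; simp
    · by_cases hk : k = s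
      · subst hk; simp [hk']
      · simp [hk, hk', hw k hk hk']
  · simp

/-- The output is summed here, as needed for column sums and for sampling; `act_localOne` sums over
the input. -/
theorem sum_localOne (B : Matrix S S ℝ) (s : ι) (F : (ι → S) → ℝ) (inp : ι → S) :
    ∑ out, localOne B s out inp * F out =
      ∑ p, B p (inp s) * F (Function.update inp s p) := by
  have := sum_agree_off_one s inp fun out => B (out s) (inp s) * F out
  simp only [Function.update_self] at this
  rw [← this]
  refine Finset.sum_congr rfl fun w _ => ?_
  simp only [localOne, Matrix.of_apply, ite_mul, zero_mul, eq_comm]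

theorem sum_localTwo (B : Matrix (S × S) (S × S) ℝ) {s t : ι} (hst : s ≠ t) (F : (ι → S) → ℝ)
    (inp : ι → S) :
    ∑ out, localTwo B s t out inp * F out =
      ∑ p : S × S, B p (inp s, inp t) *
        F (Function.update (Function.update inp s p.1) t p.2) := by
  have := sum_agree_off_two hst inp fun out => B (out s, out t) (inp s, inp t) * F out
  simp only [Function.update_self, Function.update_of_ne hst] at this
  rw [← this]
  refine Finset.sum_congr rfl fun w _ => ?_
  simp only [localTwo, Matrix.of_apply, ite_mul, zero_mul, eq_comm]

theorem act_localOne {E : Type*} [AddCommGroup E] [Module ℝ E] (B : Matrix S S ℝ) (s : ι)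
    (v : (ι → S) → E) (out : ι → S) :
    act (localOne B s) v out = ∑ p, B (out s) p • v (Function.update out s p) := by
  have := sum_agree_off_one s out fun inp => B (out s) (inp s) • v inp
  simp only [Function.update_self] at this
  rw [← this]
  simp only [act, localOne, Matrix.of_apply, ite_smul, zero_smul]

theorem act_localTwo {E : Type*} [AddCommGroup E] [Module ℝ E] (B : Matrix (S × S) (S × S) ℝ)
    {s t : ι} (hst : s ≠ t) (v : (ι → S) → E) (out : ι → S) :
    act (localTwo B s t) v out =
      ∑ p : S × S, B (out s, out t) p •
        v (Function.update (Function.update out s p.1) t p.2) := by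
  have := sum_agree_off_two hst out fun inp => B (out s, out t) (inp s, inp t) • v inp
  simp only [Function.update_self, Function.update_of_ne hst] at this
  rw [← this]
  simp only [act, localTwo, Matrix.of_apply, ite_smul, zero_smul]

variable {X A : Type*} [Ring A] [Algebra ℝ A]

/-- An operator on two sites acts on the two corresponding adjacent letters of a word. -/
theorem act_localTwo_word (M : X → S → A) (B : Matrix (S × S) (S × S) ℝ) {s t : ι} (hst : s ≠ t)
    (x y : X) (G : S × S → A) (hG : ∀ o, ∑ p : S × S, B o p • (M x p.1 * M y p.2) = G o)
    {L L' : List (ι × X)} (hs : s ∉ L.map Prod.fst) (hs' : s ∉ L'.map Prod.fst)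
    (ht : t ∉ L.map Prod.fst) (ht' : t ∉ L'.map Prod.fst) (z : ι → S) :
    act (localTwo B s t) (word M (L ++ (s, x) :: (t, y) :: L')) z =
      word M L z * G (z s, z t) * word M L' z := by
  rw [act_localTwo B hst, ← hG]
  simp only [word_append, word_cons, word_update M hs, word_update M hs', word_update M ht,
    word_update M ht', Function.update_self, Function.update_of_ne hst, Finset.mul_sum,
    Finset.sum_mul, mul_assoc, smul_mul_assoc, mul_smul_comm]

/-- An operator that exchanges two letters exchanges them inside a word. -/
theorem act_localTwo_swap (M : X → S → A) (B : Matrix (S × S) (S × S) ℝ) {s t : ι} (hst : s ≠ t)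
    (x y : X) (hB : ∀ o, ∑ p : S × S, B o p • (M x p.1 * M y p.2) = M y o.2 * M x o.1)
    {L L' : List (ι × X)} (hs : s ∉ L.map Prod.fst) (hs' : s ∉ L'.map Prod.fst)
    (ht : t ∉ L.map Prod.fst) (ht' : t ∉ L'.map Prod.fst) :
    act (localTwo B s t) (word M (L ++ (s, x) :: (t, y) :: L')) =
      word M (L ++ (t, y) :: (s, x) :: L') := by
  funext z
  rw [act_localTwo_word M B hst x y _ hB hs hs' ht ht']
  simp only [word_append, word_cons, mul_assoc]

/-- The letter at `t` is moved to the left through a list of letters. -/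
theorem act_prod_move_left (M : X → S → A) {J : Type*} (js : List J) (f : J → ι) (x : J → X)
    (t : ι) (y : X) (B : J → Matrix (S × S) (S × S) ℝ)
    (hB : ∀ j ∈ js, ∀ o, ∑ p : S × S, B j o p • (M (x j) p.1 * M y p.2) = M y o.2 * M (x j) o.1)
    (L L' : List (ι × X))
    (hnd : ((L ++ js.map (fun j => (f j, x j)) ++ (t, y) :: L').map Prod.fst).Nodup) :
    act ((js.map fun j => localTwo (B j) (f j) t).prod)
        (word M (L ++ js.map (fun j => (f j, x j)) ++ (t, y) :: L')) =
      word M (L ++ (t, y) :: (js.map (fun j => (f j, x j)) ++ L')) := by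
  induction js generalizing L with
  | nil => simp [act_one]
  | cons j js ih =>
    -- The rightmost operator acts first, so the letter crosses the tail of `js` before it meets `f
    -- j`, which meanwhile belongs to the prefix.
    have h1 := ih (fun j hj => hB j (List.mem_cons_of_mem _ hj)) (L ++ [(f j, x j)])
      (by simpa using hnd)
    simp only [List.append_assoc, List.nil_append, List.cons_append, List.map_cons,
      List.prod_cons, act_mul] at h1 ⊢
    rw [h1]
    simp only [List.map_cons, List.map_append, List.nodup_append, List.nodup_cons, List.mem_cons,
      List.mem_append] at hnd
    apply act_localTwo_swap M (B j) _ (x j) y (hB j (by simp)) <;> grind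

/-- The letter at `t` is moved to the right through a list of letters. -/
theorem act_prod_move_right (M : X → S → A) {J : Type*} (js : List J) (f : J → ι) (x : J → X)
    (t : ι) (y : X) (B : J → Matrix (S × S) (S × S) ℝ)
    (hB : ∀ j ∈ js, ∀ o, ∑ p : S × S, B j o p • (M y p.1 * M (x j) p.2) = M (x j) o.2 * M y o.1)
    (L L' : List (ι × X))
    (hnd : ((L ++ (t, y) :: (js.reverse.map (fun j => (f j, x j)) ++ L')).map Prod.fst).Nodup) :
    act ((js.map fun j => localTwo (B j) t (f j)).prod)
        (word M (L ++ (t, y) :: (js.reverse.map (fun j => (f j, x j)) ++ L'))) =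
      word M (L ++ js.reverse.map (fun j => (f j, x j)) ++ (t, y) :: L') := by
  induction js generalizing L' with
  | nil => simp [act_one]
  | cons j js ih =>
    -- The operator of the last `j` acts first and needs its letter directly to the right of `t`;
    -- this is why the letters stand in the order `js.reverse`.
    have h1 := ih (fun j hj => hB j (List.mem_cons_of_mem _ hj)) ((f j, x j) :: L')
      (by simpa using hnd)
    simp only [List.append_assoc, List.nil_append, List.cons_append, List.map_cons,
      List.prod_cons, act_mul, List.reverse_cons, List.map_append, List.map_nil] at h1 ⊢
    rw [h1]
    simp only [List.map_cons, List.map_append, List.nodup_append, List.nodup_cons, List.mem_cons,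
      List.mem_append, List.reverse_cons, List.map_nil] at hnd
    have h2 := act_localTwo_swap M (B j) (s := t) (t := f j) (by grind) y (x j) (hB j (by simp))
      (L := L ++ js.reverse.map (fun j => (f j, x j))) (L' := L')
      (by grind) (by grind) (by grind) (by grind)
    simpa using h2

/-- A boundary relation holds only under the functional and only for the letter adjacent to `⟨W|`.
It is therefore required with an arbitrary right factor, which will be the rest of the word. -/
theorem act_localOne_head {E : Type*} [AddCommGroup E] [Module ℝ E] (φ : A →ₗ[ℝ] E)
    (M : X → S → A) (B : Matrix S S ℝ) (s : ι) (x y : X)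
    (hB : ∀ o a, φ ((∑ p, B o p • M x p) * a) = φ (M y o * a))
    {L : List (ι × X)} (hs : s ∉ L.map Prod.fst) :
    act (localOne B s) (fun z => φ (word M ((s, x) :: L) z)) =
      fun z => φ (word M ((s, y) :: L) z) := by
  funext z
  rw [act_localOne]
  simp only [word_cons, word_update M hs, Function.update_self]
  rw [← hB, Finset.sum_mul, map_sum]
  simp

theorem act_localOne_last {E : Type*} [AddCommGroup E] [Module ℝ E] (φ : A →ₗ[ℝ] E)
    (M : X → S → A) (B : Matrix S S ℝ) (s : ι) (x y : X)
    (hB : ∀ o a, φ (a * ∑ p, B o p • M x p) = φ (a * M y o))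
    {L : List (ι × X)} (hs : s ∉ L.map Prod.fst) :
    act (localOne B s) (fun z => φ (word M (L ++ [(s, x)]) z)) =
      fun z => φ (word M (L ++ [(s, y)]) z) := by
  funext z
  rw [act_localOne]
  simp only [word_append, word_cons, word_nil, mul_one, word_update M hs, Function.update_self]
  rw [← hB, Finset.mul_sum, map_sum]
  simp

end LocalOperators

/-! ### The unfused exchange relations -/

section Unfused

variable {A : Type*} [Ring A] [Algebra ℝ A]

/-- `M_0(u) = u + e` and `M_1(u) = 1/u + d`, for a real parameter `u`. -/
def letter (dOp eOp : A) (u : ℝ) (z : Fin 2) : A :=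
  if z = 0 then algebraMap ℝ A u + eOp else algebraMap ℝ A u⁻¹ + dOp

theorem unfusedR_apply (q u : ℝ) (o p : Fin 2 × Fin 2) :
    unfusedR q u o p =
      if o.1 = o.2 then if p = o then 1 else 0
      else if p = o then if o.1 = 0 then q * (1 - u) / (1 - q * u) else (1 - u) / (1 - q * u)
      else if p = o.swap then
        if o.1 = 0 then u * (1 - q) / (1 - q * u) else (1 - q) / (1 - q * u)
      else 0 := by
  obtain ⟨o1, o2⟩ := o
  obtain ⟨p1, p2⟩ := p
  fin_cases o1 <;> fin_cases o2 <;> fin_cases p1 <;> fin_cases p2 <;> rfl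

/-- Writing `de` as `q ed + (1 - q)` on both sides leaves an identity of scalar coefficients in each
of the four components. The index `o.1` stays with the parameter `x`: only the order of
multiplication changes, not the site of a letter. -/
theorem letter_exchange {dOp eOp : A} {q : ℝ}
    (hde : dOp * eOp - q • (eOp * dOp) = algebraMap ℝ A (1 - q)) {x y : ℝ} (hx : x ≠ 0)
    (hy : y ≠ 0) (hxy : 1 - q * (x / y) ≠ 0) (o : Fin 2 × Fin 2) :
    ∑ p, unfusedR q (x / y) o p • (letter dOp eOp x p.1 * letter dOp eOp y p.2) =
      letter dOp eOp y o.2 * letter dOp eOp x o.1 := by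
  have hde' : dOp * eOp = q • (eOp * dOp) + (1 - q) • (1 : A) := by
    rw [← Algebra.algebraMap_eq_smul_one, ← hde]; abel
  have hxy' : y - q * x ≠ 0 := by
    intro h; apply hxy; field_simp; linarith
  obtain ⟨o1, o2⟩ := o
  simp only [Fintype.sum_prod_type, Fin.sum_univ_two, unfusedR_apply]
  fin_cases o1 <;> fin_cases o2 <;>
    simp [letter, Algebra.algebraMap_eq_smul_one, add_mul, mul_add, hde'] <;>
    match_scalars <;> field_simp <;> ring

/-- The two sides differ by a scalar multiple of `a e - c d + 1`, which `φ` kills on the left. The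
multiples for `o = 0` and `o = 1` are opposite, since `M_0(u) + M_1(u)` is invariant under `u ↦
1/u`. -/
theorem letter_left_boundary {E : Type*} [AddCommGroup E] [Module ℝ E] (φ : A →ₗ[ℝ] E)
    {dOp eOp : A} {a c : ℝ} (hφ : ∀ x, φ ((a • eOp - c • dOp + 1) * x) = 0) {u : ℝ} (hu : u ≠ 0)
    (hD : c * u ^ 2 + u - a ≠ 0) (o : Fin 2) (x : A) :
    φ ((∑ p, unfusedK a c u o p • letter dOp eOp u⁻¹ p) * x) = φ (letter dOp eOp u o * x) := by
  -- The denominator becomes a variable of its own, so that it can be cancelled as an atom.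
  obtain ⟨D, rfl⟩ : ∃ D, a = c * u ^ 2 + u - D := ⟨c * u ^ 2 + u - a, by ring⟩
  have hden : c * u ^ 2 + u - (c * u ^ 2 + u - D) = D := by ring
  rw [hden] at hD
  have key : ∑ p, unfusedK (c * u ^ 2 + u - D) c u o p • letter dOp eOp u⁻¹ p = letter dOp eOp u o +
      ((if o = 0 then 1 else -1) * (1 - u ^ 2) / D) •
        ((c * u ^ 2 + u - D) • eOp - c • dOp + 1) := by
    fin_cases o <;>
      simp [letter, Algebra.algebraMap_eq_smul_one, unfusedK, hden] <;>
      match_scalars <;> field_simp <;> ring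
  rw [key, add_mul, map_add, smul_mul_assoc, map_smul, hφ, smul_zero, add_zero]

theorem letter_right_boundary {E : Type*} [AddCommGroup E] [Module ℝ E] (φ : A →ₗ[ℝ] E)
    {dOp eOp : A} {b d : ℝ} (hφ : ∀ x, φ (x * (b • dOp - d • eOp + 1)) = 0) {u : ℝ} (hu : u ≠ 0)
    (hD : b * u ^ 2 - u - d ≠ 0) (o : Fin 2) (x : A) :
    φ (x * ∑ p, unfusedKbar b d u o p • letter dOp eOp u⁻¹ p) = φ (x * letter dOp eOp u o) := by
  obtain ⟨D, rfl⟩ : ∃ D, d = b * u ^ 2 - u - D := ⟨b * u ^ 2 - u - d, by ring⟩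
  have hden : b * u ^ 2 - u - (b * u ^ 2 - u - D) = D := by ring
  rw [hden] at hD
  have key : ∑ p, unfusedKbar b (b * u ^ 2 - u - D) u o p • letter dOp eOp u⁻¹ p = letter dOp eOp u o +
      ((if o = 0 then 1 else -1) * (u ^ 2 - 1) / D) •
        (b • dOp - (b * u ^ 2 - u - D) • eOp + 1) := by
    fin_cases o <;>
      simp [letter, Algebra.algebraMap_eq_smul_one, unfusedKbar, hden] <;>
      match_scalars <;> field_simp <;> ring
  rw [key, mul_add, map_add, mul_smul_comm, map_smul, hφ, smul_zero, add_zero]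

end Unfused

/-! ### Inverting the unfused `R` matrix -/

section Inverse

variable {ι S : Type*} [Fintype ι] [DecidableEq ι] [DecidableEq S]

theorem localTwo_swap (B : Matrix (S × S) (S × S) ℝ) (s t : ι) :
    localTwo (B.submatrix Prod.swap Prod.swap) s t = localTwo B t s := by
  ext out inp
  simp only [localTwo, Matrix.of_apply, Matrix.submatrix_apply, Prod.swap_prod_mk]
  congr 1
  exact propext (forall_congr' fun k => forall_comm)

/-- Unitarity, `R_{12}(u) R_{21}(1/u) = 1`. It turns the inverses in `fusionOpKbar` into ordinary
`R` matrices at inverse parameters with the two sites interchanged, so that their exchange relations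
and their positivity need no separate treatment. -/
theorem unfusedR_mul_swap {q u : ℝ} (hu : u ≠ 0) (h : 1 - q * u ≠ 0) (h' : 1 - q * u⁻¹ ≠ 0) :
    unfusedR q u * (unfusedR q u⁻¹).submatrix Prod.swap Prod.swap = 1 := by
  have h2 : u - q ≠ 0 := by
    intro h3; apply h'; field_simp; linarith
  ext ⟨o1, o2⟩ ⟨p1, p2⟩
  simp only [Matrix.mul_apply, Fintype.sum_prod_type, Fin.sum_univ_two, unfusedR_apply,
    Matrix.submatrix_apply, Matrix.one_apply]
  fin_cases o1 <;> fin_cases o2 <;> fin_cases p1 <;> fin_cases p2 <;>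
    simp <;> field_simp <;> ring

theorem actTwo_inv_unfusedR {q u : ℝ} (hu : u ≠ 0) (h : 1 - q * u ≠ 0) (h' : 1 - q * u⁻¹ ≠ 0)
    (s t : ι) : actTwo (unfusedR q u)⁻¹ s t = actTwo (unfusedR q u⁻¹) t s := by
  rw [Matrix.inv_eq_right_inv (unfusedR_mul_swap hu h h')]
  exact localTwo_swap _ s t

end Inverse

/-! ### Inversions and exchangeability -/

theorem total_cons {I : ℕ} (a : Fin 2) (z : Fin I → Fin 2) :
    total (Fin.cons a z : Fin (I + 1) → Fin 2) = a + total z := by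
  simp [total, Fin.sum_univ_succ]

theorem total_le {I : ℕ} (z : Fin I → Fin 2) : total z ≤ I := by
  unfold total
  calc ∑ i, (z i : ℕ) ≤ ∑ _i : Fin I, 1 := Finset.sum_le_sum fun i _ => by omega
    _ = I := by simp

/-- The number `m` counts the zeros of `z`: a leading one is inverted with each of them, a leading
zero with none. -/
theorem inversions_cons {I : ℕ} (a : Fin 2) (z : Fin I → Fin 2) {m : ℕ} (hm : m + total z = I) :
    inversions (Fin.cons a z : Fin (I + 1) → Fin 2) = (a : ℕ) * m + inversions z := by
  have hz : ∑ j, (if z j < a then 1 else 0) = (a : ℕ) * m := by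
    have : ∀ j, (if z j < a then 1 else 0) + (a : ℕ) * (z j : ℕ) = (a : ℕ) := by
      intro j
      generalize z j = b
      revert a b; decide
    have h2 := Finset.sum_congr rfl fun j (_ : j ∈ (Finset.univ : Finset (Fin I))) => this j
    rw [Finset.sum_add_distrib, ← Finset.mul_sum] at h2
    simp only [Finset.sum_const, Finset.card_univ, Fintype.card_fin, smul_eq_mul] at h2
    change _ + (a : ℕ) * total z = _ at h2
    nlinarith
  unfold inversions
  simp only [Finset.card_filter, Fintype.sum_prod_type, Fin.sum_univ_succ, Fin.cons_zero,
    Fin.cons_succ, false_and, if_false, Fin.succ_pos, true_and, Fin.succ_lt_succ_iff,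
    Fin.not_lt_zero, zero_add, hz]

section Exchangeable

variable {A : Type*} [Ring A] [Algebra ℝ A]

/-- The word `M_0(u) ⋯ M_0(u q^(m-1)) M_1(u q^m) ⋯ M_1(u q^(m+j-1))`. -/
def sortedWord (dOp eOp : A) (q : ℝ) : ℕ → ℕ → ℝ → A
  | 0, 0, _ => 1
  | 0, j + 1, u => letter dOp eOp u 1 * sortedWord dOp eOp q 0 j (u * q)
  | m + 1, j, u => letter dOp eOp u 0 * sortedWord dOp eOp q m j (u * q)

set_option linter.unnecessarySeqFocus false in
-- At parameters of ratio `q` the letters `M_1` and `M_0` can be reordered at the cost of a factor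
-- `q` while the parameters stay in place. This is the source of `q`-exchangeability.
theorem letter_one_mul_letter_zero {dOp eOp : A} {q : ℝ}
    (hde : dOp * eOp - q • (eOp * dOp) = algebraMap ℝ A (1 - q)) {u : ℝ} (hq : q ≠ 0)
    (hu : u ≠ 0) :
    letter dOp eOp u 1 * letter dOp eOp (u * q) 0 =
      q • (letter dOp eOp u 0 * letter dOp eOp (u * q) 1) := by
  have hde' : dOp * eOp = q • (eOp * dOp) + (1 - q) • (1 : A) := by
    rw [← Algebra.algebraMap_eq_smul_one, ← hde]; abel
  simp [letter, Algebra.algebraMap_eq_smul_one, add_mul, mul_add, hde']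
  match_scalars <;> field_simp <;> ring

theorem letter_one_mul_sortedWord {dOp eOp : A} {q : ℝ}
    (hde : dOp * eOp - q • (eOp * dOp) = algebraMap ℝ A (1 - q)) (hq : q ≠ 0) (m j : ℕ) {u : ℝ}
    (hu : u ≠ 0) :
    letter dOp eOp u 1 * sortedWord dOp eOp q m j (u * q) =
      q ^ m • sortedWord dOp eOp q m (j + 1) u := by
  induction m generalizing u with
  | zero => simp [sortedWord]
  | succ m ih =>
    rw [sortedWord, ← mul_assoc, letter_one_mul_letter_zero hde hq hu, smul_mul_assoc, mul_assoc,
      ih (mul_ne_zero hu hq), sortedWord, mul_smul_comm, smul_smul, pow_succ']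

/-- Sorting from the right end of the word: a leading one passes through the `m` zeros of the sorted
remainder and collects `q ^ m`, which is the number of new inversions in the exponent. -/
theorem prod_letter_eq_sortedWord {dOp eOp : A} {q : ℝ}
    (hde : dOp * eOp - q • (eOp * dOp) = algebraMap ℝ A (1 - q)) (hq : q ≠ 0) {I : ℕ}
    (z : Fin I → Fin 2) {u : ℝ} (hu : u ≠ 0) {m : ℕ} (hm : m + total z = I) :
    ((List.finRange I).map fun i : Fin I => letter dOp eOp (u * q ^ (i : ℕ)) (z i)).prod =
      q ^ inversions z • sortedWord dOp eOp q m (total z) u := by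
  induction I generalizing u m with
  | zero =>
    have h1 : m = 0 := by omega
    have h2 : total z = 0 := by simp [total]
    simp [h1, h2, inversions, sortedWord]
  | succ I ih =>
    obtain ⟨a, z, rfl⟩ : ∃ a z', z = Fin.cons a z' := ⟨_, _, (Fin.cons_self_tail z).symm⟩
    have hz := total_le z
    have hz' : (I - total z) + total z = I := by omega
    have h1 := ih z (mul_ne_zero hu hq) hz'
    rw [total_cons] at hm ⊢
    rw [inversions_cons a z hz', List.finRange_succ, List.map_cons, List.prod_cons, List.map_map]
    have h2 : ((fun i : Fin (I + 1) => letter dOp eOp (u * q ^ (i : ℕ)) ((Fin.cons a z : Fin (I + 1) → Fin 2) i))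
        ∘ Fin.succ) = fun i : Fin I => letter dOp eOp (u * q * q ^ (i : ℕ)) (z i) := by
      funext i; simp [pow_succ', mul_assoc]
    rw [h2, h1]
    simp only [Fin.val_zero, pow_zero, mul_one, Fin.cons_zero]
    obtain rfl | rfl : a = 0 ∨ a = 1 := by omega
    · have : m = (I - total z) + 1 := by simp at hm; omega
      subst this
      simp [sortedWord]
    · have : m = I - total z := by simp at hm; omega
      subst this
      rw [mul_smul_comm, letter_one_mul_sortedWord hde hq _ _ hu, smul_smul, pow_add]
      simp [mul_comm, add_comm]

end Exchangeable

/-! ### Fusion of the exchange relations -/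

theorem partitionZ_pos {I : ℕ} {q : ℝ} (hq : 0 < q) (z : Fin I → Fin 2) :
    0 < partitionZ I q (total z) := by
  refine Finset.sum_pos' (fun w _ => ?_) ⟨z, Finset.mem_univ _, ?_⟩
  · split_ifs <;> positivity
  · simp [pow_pos hq]

/-- On an exchangeable vector, `Π` collects `Z_j • g j` on level `j`, and `Π̂` redistributes it in
the proportions `q ^ inv / Z_j`, which are those of the vector itself. -/
theorem act_incl_mul_proj {E : Type*} [AddCommGroup E] [Module ℝ E] {I : ℕ} {q : ℝ} (hq : 0 < q)
    {v : (Fin I → Fin 2) → E} (g : ℕ → E) (hv : ∀ z, v z = q ^ inversions z • g (total z)) :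
    act (incl I q * proj I) v = v := by
  have h1 : ∀ j : Fin (I + 1), act (proj I) v j = partitionZ I q j • g j := by
    intro j
    simp only [act, proj, partitionZ, Matrix.of_apply, Finset.sum_smul, ite_smul, one_smul,
      zero_smul]
    refine Finset.sum_congr rfl fun z _ => ?_
    split_ifs with h
    · rw [hv, h]
    · rfl
  rw [act_mul]
  funext z
  have hz : total z < I + 1 := Nat.lt_succ_of_le (total_le z)
  have h2 : act (incl I q) (act (proj I) v) z =
      ∑ j : Fin (I + 1), if j = ⟨total z, hz⟩ then v z else 0 := by
    simp only [act.eq_1 (incl I q)]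
    refine Finset.sum_congr rfl fun j _ => ?_
    rw [h1]
    simp only [incl, Matrix.of_apply]
    by_cases hj : j = ⟨total z, hz⟩
    · subst hj
      rw [if_pos rfl, if_pos rfl, smul_smul, div_mul_cancel₀ _ (partitionZ_pos hq z).ne', hv]
    · rw [if_neg hj, if_neg fun h => hj (Fin.ext h.symm), zero_smul]
  rw [h2]
  simp

theorem prod_map_ite {J α : Type*} [Monoid α] (l : List J) (p : J → Prop) [DecidablePred p]
    (f : J → α) :
    (l.map fun j => if p j then f j else 1).prod = ((l.filter fun j => p j).map f).prod := by
  induction l with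
  | nil => rfl
  | cons j l ih =>
    by_cases h : p j <;> simp [h, ih]

theorem act_reversal {E : Type*} [AddCommGroup E] [Module ℝ E] {I : ℕ}
    (v : (Fin I → Fin 2) → E) : act (reversal I) v = fun z => v (z ∘ Fin.rev) := by
  funext z
  have : ∀ w : Fin I → Fin 2, (z = w ∘ Fin.rev) = (w = z ∘ Fin.rev) := by
    intro w
    refine propext ⟨fun h => ?_, fun h => ?_⟩ <;> (rw [h]; funext i; simp)
  simp [act, reversal, ite_smul, this]

theorem act_kronecker {m n m' n' A : Type*} [Fintype n] [Fintype n'] [Ring A] [Algebra ℝ A]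
    (B : Matrix m n ℝ) (C : Matrix m' n' ℝ) (v : n → A) (w : n' → A) :
    act (B ⊗ₖ C) (fun p => v p.1 * w p.2) = fun o => act B v o.1 * act C w o.2 := by
  funext o
  simp only [act, Fintype.sum_prod_type, Matrix.kroneckerMap_apply, Finset.sum_mul_sum,
    smul_mul_smul_comm]

theorem act_kronecker_swap {m n m' n' A : Type*} [Fintype n] [Fintype n'] [Ring A] [Algebra ℝ A]
    (B : Matrix m n ℝ) (C : Matrix m' n' ℝ) (v : n → A) (w : n' → A) :
    act (B ⊗ₖ C) (fun p => w p.2 * v p.1) = fun o => act C w o.2 * act B v o.1 := by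
  funext o
  simp only [act, Fintype.sum_prod_type_right, Matrix.kroneckerMap_apply, Finset.sum_mul_sum,
    smul_mul_smul_comm, mul_comm (C _ _)]

theorem act_reindex {m n E : Type*} [Fintype m] [Fintype n] [AddCommGroup E] [Module ℝ E]
    (e : m ≃ n) (B : Matrix m m ℝ) (v : n → E) :
    act (Matrix.reindex e e B) v = fun o => act B (fun i => v (e i)) (e.symm o) := by
  funext o
  simp only [act, Matrix.reindex_apply, Matrix.submatrix_apply]
  exact Fintype.sum_equiv e.symm _ _ (by simp)

section Fusion

variable {A : Type*} [Ring A] [Algebra ℝ A] {I : ℕ}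

/-- The spectral parameters of the factors of a fused letter. -/
def chain (q x : ℝ) (i : Fin I) : ℝ := x * q ^ (-((I : ℝ) + 1) / 2 + idx i)

/-- The spectral parameters of the factors of a fused `K` matrix. -/
def bdry (q u : ℝ) (i : Fin I) : ℝ := u * q ^ (((I : ℝ) + 1) / 2 - idx i)

/-- The vector of words of which a fused letter consists. -/
def fusedWord (dOp eOp : A) (I : ℕ) (q x : ℝ) : (Fin I → Fin 2) → A :=
  word (letter dOp eOp) ((List.finRange I).map fun i => (i, chain q x i))

/-- The fused elements, for a real spectral parameter. -/
def fusedLetter (dOp eOp : A) (I : ℕ) (q x : ℝ) : Fin (I + 1) → A :=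
  act (proj I) (fusedWord dOp eOp I q x)

theorem chain_ne_zero {q x : ℝ} (hq : 0 < q) (hx : x ≠ 0) (i : Fin I) : chain q x i ≠ 0 :=
  mul_ne_zero hx (Real.rpow_pos_of_pos hq _).ne'

theorem bdry_ne_zero {q x : ℝ} (hq : 0 < q) (hx : x ≠ 0) (i : Fin I) : bdry q x i ≠ 0 :=
  mul_ne_zero hx (Real.rpow_pos_of_pos hq _).ne'

/-- Inverting the parameter and reversing the factors (`bdry_rev`) both turn the exponents of a `K`
matrix, decreasing in `i`, into those of a fused letter, increasing in `i`. So the unreflected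
letters spell the word at `u⁻¹`, and the reflected ones, which end up in reversed order, spell the
word at `u` after `reversal`. -/
theorem inv_bdry {q : ℝ} (hq : 0 < q) (u : ℝ) (i : Fin I) :
    (bdry q u i)⁻¹ = chain q u⁻¹ i := by
  rw [bdry, chain, mul_inv, ← Real.rpow_neg hq.le]
  congr 2; ring

theorem bdry_rev {q : ℝ} (u : ℝ) (i : Fin I) : bdry q u i.rev = chain q u i := by
  rw [bdry, chain]
  congr 2
  have : ((i.rev : ℕ) : ℝ) = (I : ℝ) - (i + 1) := by
    rw [Fin.val_rev, Nat.cast_sub (by omega)]; push_cast; ring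
  rw [idx, idx, this]; ring

theorem bdry_mul_bdry {q : ℝ} (hq : 0 < q) (u : ℝ) (i j : Fin I) :
    bdry q u j * bdry q u i = u ^ 2 * q ^ ((I : ℝ) + 1 - idx i - idx j) := by
  rw [bdry, bdry, mul_mul_mul_comm, ← Real.rpow_add hq, pow_two]
  congr 2; ring

theorem chain_div_chain {q : ℝ} (hq : 0 < q) (x y : ℝ) (i j : Fin I) :
    chain q x j / chain q y i = x / y * q ^ (idx j - idx i) := by
  rw [chain, chain, mul_div_mul_comm, ← Real.rpow_sub hq]
  congr 2; ring

/-- This is what makes fusion work: a fused letter determines the full word, so a fused operator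
acts on it through its unfused factors. -/
theorem fusedWord_exchangeable {dOp eOp : A} {q : ℝ} (hq : 0 < q)
    (hde : dOp * eOp - q • (eOp * dOp) = algebraMap ℝ A (1 - q)) {x : ℝ} (hx : x ≠ 0) :
    act (incl I q) (fusedLetter dOp eOp I q x) = fusedWord dOp eOp I q x := by
  rw [fusedLetter, ← act_mul]
  refine act_incl_mul_proj hq
    -- The starting parameter is that of the first factor, whose one-based index is `1`.
    (fun j => sortedWord dOp eOp q (I - j) j (x * q ^ (-((I : ℝ) + 1) / 2 + 1))) fun z => ?_
  rw [← prod_letter_eq_sortedWord hde hq.ne' z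
    (mul_ne_zero hx (Real.rpow_pos_of_pos hq _).ne') (Nat.sub_add_cancel (total_le z)),
    fusedWord, word, List.map_map]
  congr 1
  refine List.map_congr_left fun i _ => ?_
  simp only [Function.comp, chain, idx]
  rw [mul_assoc, ← Real.rpow_natCast, ← Real.rpow_add hq]
  congr 3; ring

/-- The letters with parameters from `y` cross the block of `x` one at a time, the leftmost first:
in the decreasing outer product the factor of index `1` acts first. In `main`, the list `L` contains
the letters that have crossed and `as` those that have not. -/
theorem act_fusionOpR {dOp eOp : A} {q : ℝ} (hq : 0 < q)
    (hde : dOp * eOp - q • (eOp * dOp) = algebraMap ℝ A (1 - q)) {x y : ℝ} (hx : x ≠ 0)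
    (hy : y ≠ 0) (hxy : ∀ i j : Fin I, 1 - q * (x / y * q ^ (idx j - idx i)) ≠ 0) :
    act (fusionOpR I q (x / y)) (word (letter dOp eOp)
        ((List.finRange I).map (fun j => (Sum.inl j, chain q x j)) ++
          (List.finRange I).map fun i => (Sum.inr i, chain q y i))) =
      word (letter dOp eOp)
        ((List.finRange I).map (fun i => (Sum.inr i, chain q y i)) ++
          (List.finRange I).map fun j => (Sum.inl j, chain q x j)) := by
  have main : ∀ (as : List (Fin I)) (L : List ((Fin I ⊕ Fin I) × ℝ)),
      ((L ++ (List.finRange I).map (fun j => (Sum.inl j, chain q x j)) ++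
          as.map fun i => (Sum.inr i, chain q y i)).map Prod.fst).Nodup →
      act ((as.reverse.map fun a : Fin I => prodInc fun b : Fin I =>
          actTwo (unfusedR q (x / y * q ^ (idx b - idx a))) (Sum.inl b) (Sum.inr a)).prod)
        (word (letter dOp eOp)
          (L ++ (List.finRange I).map (fun j => (Sum.inl j, chain q x j)) ++
            as.map fun i => (Sum.inr i, chain q y i))) =
      word (letter dOp eOp)
        (L ++ as.map (fun i => (Sum.inr i, chain q y i)) ++
          (List.finRange I).map fun j => (Sum.inl j, chain q x j)) := by
    intro as
    induction as with
    | nil => intro L _; simp [act_one]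
    | cons a as ih =>
      intro L hnd
      rw [List.reverse_cons, List.map_append, List.prod_append, act_mul, List.map_singleton,
        List.prod_singleton, List.map_cons]
      have h1 := act_prod_move_left (letter dOp eOp) (List.finRange I) Sum.inl (chain q x)
        (Sum.inr a) (chain q y a) (fun b => unfusedR q (x / y * q ^ (idx b - idx a)))
        (fun j _ o => by
          rw [← chain_div_chain hq]
          apply letter_exchange hde (chain_ne_zero hq hx j) (chain_ne_zero hq hy a)
          rw [chain_div_chain hq]; exact hxy a j)
        L (as.map fun i => (Sum.inr i, chain q y i)) hnd
      have h2 := ih (L ++ [(Sum.inr a, chain q y a)]) (by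
        refine (List.Perm.nodup_iff (List.Perm.map _ ?_)).1 hnd
        simp only [List.append_assoc, List.map_cons, List.singleton_append]
        exact List.Perm.append_left _ List.perm_middle)
      simp only [List.append_assoc, List.cons_append, List.nil_append] at h1 h2 ⊢
      rw [← h2]
      congr 1
  have h := main (List.finRange I) [] (by
    simp only [List.nil_append, List.map_append, List.map_map, List.nodup_append]
    refine ⟨?_, ?_, ?_⟩
    · exact (List.nodup_finRange I).map Sum.inl_injective
    · exact (List.nodup_finRange I).map Sum.inr_injective
    · simp)
  simpa [fusionOpR, prodDec] using h

/-- The exchange relation of the fused letters. -/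
theorem fusedLetter_exchange {dOp eOp : A} {q : ℝ} (hq : 0 < q)
    (hde : dOp * eOp - q • (eOp * dOp) = algebraMap ℝ A (1 - q)) {x y : ℝ} (hx : x ≠ 0)
    (hy : y ≠ 0) (hxy : ∀ i j : Fin I, 1 - q * (x / y * q ^ (idx j - idx i)) ≠ 0)
    (o : Fin (I + 1) × Fin (I + 1)) :
    ∑ p, fusedR I q (x / y) o p •
        (fusedLetter dOp eOp I q x p.1 * fusedLetter dOp eOp I q y p.2) =
      fusedLetter dOp eOp I q y o.2 * fusedLetter dOp eOp I q x o.1 := by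
  change act (fusedR I q (x / y)) (fun p =>
    fusedLetter dOp eOp I q x p.1 * fusedLetter dOp eOp I q y p.2) o = _
  -- `Π̂ ⊗ Π̂` replaces the two fused letters by their words, whose concatenation is the word on
  -- `2I` sites.
  rw [fusedR, act_mul, act_mul, act_kronecker, fusedWord_exchangeable hq hde hx,
    fusedWord_exchangeable hq hde hy, act_reindex]
  have h1 := act_fusionOpR hq hde hx hy hxy
  have h2 : (fun z => fusedWord dOp eOp I q x
        (Equiv.sumArrowEquivProdArrow (Fin I) (Fin I) (Fin 2) z).1 *
      fusedWord dOp eOp I q y (Equiv.sumArrowEquivProdArrow (Fin I) (Fin I) (Fin 2) z).2) =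
      word (letter dOp eOp)
        ((List.finRange I).map (fun j => (Sum.inl j, chain q x j)) ++
          (List.finRange I).map fun i => (Sum.inr i, chain q y i)) := by
    funext z
    rw [word_append]
    simp only [fusedWord, word, List.map_map]
    rfl
  rw [h2, h1]
  have h3 : (fun p : (Fin I → Fin 2) × (Fin I → Fin 2) => word (letter dOp eOp)
        ((List.finRange I).map (fun i => (Sum.inr i, chain q y i)) ++
          (List.finRange I).map fun j => (Sum.inl j, chain q x j))
        ((Equiv.sumArrowEquivProdArrow (Fin I) (Fin I) (Fin 2)).symm p)) =
      fun p => fusedWord dOp eOp I q y p.2 * fusedWord dOp eOp I q x p.1 := by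
    funext p
    rw [word_append]
    simp only [fusedWord, word, List.map_map]
    rfl
  rw [h3, act_kronecker_swap]
  rfl

theorem act_reversal_fusedWord {E : Type*} [AddCommGroup E] [Module ℝ E] (φ : A →ₗ[ℝ] E)
    (dOp eOp : A) (q u : ℝ) :
    act (reversal I) (fun z => φ (word (letter dOp eOp)
        ((List.finRange I).reverse.map fun i => (i, bdry q u i)) z)) =
      fun z => φ (fusedWord dOp eOp I q u z) := by
  rw [act_reversal]
  funext z
  congr 1
  rw [fusedWord, word, word, List.finRange_reverse, List.map_map, List.map_map, List.map_map]
  congr 1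
  refine List.map_congr_left fun i _ => ?_
  simp [bdry_rev]

/-- The left boundary relation of the fused letters. -/
theorem fusedLetter_left_boundary {E : Type*} [AddCommGroup E] [Module ℝ E] (φ : A →ₗ[ℝ] E)
    {dOp eOp : A} {q a c : ℝ} (hq : 0 < q)
    (hde : dOp * eOp - q • (eOp * dOp) = algebraMap ℝ A (1 - q))
    (hφ : ∀ x, φ ((a • eOp - c • dOp + 1) * x) = 0) {u : ℝ} (hu : u ≠ 0)
    (hD : ∀ i : Fin I, c * bdry q u i ^ 2 + bdry q u i - a ≠ 0)
    (hR : ∀ i j : Fin I, j < i → 1 - q * (bdry q u j * bdry q u i) ≠ 0) (o : Fin (I + 1)) :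
    ∑ p, fusedK I q a c u o p • φ (fusedLetter dOp eOp I q u⁻¹ p) =
      φ (fusedLetter dOp eOp I q u o) := by
  -- The letters of `pre` have been reflected: they stand at the left in reversed order with
  -- parameters `bdry`. Those of `post` still have the inverse parameters. The next letter `i`
  -- crosses all of `pre` by means of the `R` factors, reaches `⟨W|`, and is reflected by `K_i`.
  have main : ∀ post pre : List (Fin I), List.finRange I = pre ++ post →
      act ((post.reverse.map fun i : Fin I =>
          actOne (unfusedK a c (u * q ^ (((I : ℝ) + 1) / 2 - idx i))) i *
            prodDec fun j : Fin I => if j < i then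
              actTwo (unfusedR q (u ^ 2 * q ^ ((I : ℝ) + 1 - idx i - idx j))) j i else 1).prod)
        (fun z => φ (word (letter dOp eOp) (pre.reverse.map (fun i => (i, bdry q u i)) ++
            post.map fun i => (i, (bdry q u i)⁻¹)) z)) =
      fun z => φ (word (letter dOp eOp)
        ((List.finRange I).reverse.map fun i => (i, bdry q u i)) z) := by
    intro post
    induction post with
    | nil => intro pre h; simp [h, act_one]
    | cons i post ih =>
      intro pre h
      have hsort := List.pairwise_lt_finRange I
      have hnd := List.nodup_finRange I
      rw [h] at hsort hnd
      rw [← ih (pre ++ [i]) (by simpa using h), List.reverse_cons, List.map_append,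
        List.prod_append, act_mul, List.map_singleton, List.prod_singleton]
      congr 1
      have hfilter : (List.finRange I).reverse.filter (fun j => j < i) = pre.reverse := by
        rw [h]
        simp only [List.pairwise_append, List.pairwise_cons] at hsort
        rw [List.reverse_append, List.filter_append, List.reverse_cons, List.filter_append]
        have e1 : post.reverse.filter (fun j => decide (j < i)) = [] := by
          rw [List.filter_eq_nil_iff]; grind
        have e2 : pre.reverse.filter (fun j => decide (j < i)) = pre.reverse := by
          rw [List.filter_eq_self]; grind
        rw [e1, e2]; simp
      rw [prodDec, prod_map_ite, hfilter, act_mul, act_comp]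
      have h1 := act_prod_move_left (letter dOp eOp) pre.reverse id (bdry q u) i (bdry q u i)⁻¹
        (fun j => unfusedR q (u ^ 2 * q ^ ((I : ℝ) + 1 - idx i - idx j)))
        (fun j hj o => by
          -- Letter `i` still has parameter `(bdry q u i)⁻¹` when it crosses `j`, so the ratio of
          -- the two parameters is the product of the `bdry`s.
          rw [← bdry_mul_bdry hq, ← div_inv_eq_mul]
          apply letter_exchange hde (bdry_ne_zero hq hu j) (inv_ne_zero (bdry_ne_zero hq hu i))
          rw [div_inv_eq_mul]
          refine hR i j ?_
          simp only [List.pairwise_append, List.pairwise_cons] at hsort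
          grind)
        [] (post.map fun i => (i, (bdry q u i)⁻¹)) (by
          simp only [List.nil_append, List.map_append, List.map_map, List.map_cons, id]
          simp only [Function.comp_def, List.map_id']
          simp only [List.nodup_append, List.nodup_cons, List.nodup_reverse, List.mem_reverse]
            at hnd ⊢
          exact hnd)
      simp only [List.nil_append, id] at h1
      simp only [List.map_cons]
      change act _ (fun o => φ (act ((pre.reverse.map fun j =>
        localTwo (unfusedR q (u ^ 2 * q ^ ((I : ℝ) + 1 - idx i - idx j))) j i).prod) _ o)) = _
      rw [h1]
      have h2 := act_localOne_head φ (letter dOp eOp) (unfusedK a c (bdry q u i)) i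
        (bdry q u i)⁻¹ (bdry q u i)
        (letter_left_boundary φ hφ (bdry_ne_zero hq hu i) (hD i))
        (L := pre.reverse.map (fun i => (i, bdry q u i)) ++ post.map fun i => (i, (bdry q u i)⁻¹))
        (by
          simp only [List.map_append, List.map_map, Function.comp_def, List.map_id']
          simp only [List.nodup_append, List.nodup_cons] at hnd
          grind)
      rw [actOne_eq_localOne]
      simpa [bdry] using h2
  change act (fusedK I q a c u) (fun p => φ (fusedLetter dOp eOp I q u⁻¹ p)) o = _
  rw [fusedK, act_mul, act_mul, act_comp, fusedWord_exchangeable hq hde (inv_ne_zero hu),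
    fusionOpK, act_mul]
  have h1 := main (List.finRange I) [] rfl
  have h2 : ((List.finRange I).map fun i => (i, (bdry q u i)⁻¹)) =
      (List.finRange I).map fun i => (i, chain q u⁻¹ i) := by simp only [inv_bdry hq]
  rw [List.reverse_nil, List.map_nil, List.nil_append, h2] at h1
  rw [prodDec, fusedWord, h1, act_reversal_fusedWord, act_comp]
  rfl

/-- The right boundary relation of the fused letters. -/
theorem fusedLetter_right_boundary {E : Type*} [AddCommGroup E] [Module ℝ E] (φ : A →ₗ[ℝ] E)
    {dOp eOp : A} {q b d : ℝ} (hq : 0 < q)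
    (hde : dOp * eOp - q • (eOp * dOp) = algebraMap ℝ A (1 - q))
    (hφ : ∀ x, φ (x * (b • dOp - d • eOp + 1)) = 0) {u : ℝ} (hu : u ≠ 0)
    (hD : ∀ i : Fin I, b * bdry q u i ^ 2 - bdry q u i - d ≠ 0)
    (hR : ∀ i j : Fin I, i < j → 1 - q * (bdry q u j * bdry q u i) ≠ 0)
    (hR' : ∀ i j : Fin I, i < j → 1 - q * (bdry q u j * bdry q u i)⁻¹ ≠ 0) (o : Fin (I + 1)) :
    ∑ p, fusedKbar I q b d u o p • φ (fusedLetter dOp eOp I q u⁻¹ p) =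
      φ (fusedLetter dOp eOp I q u o) := by
  have main : ∀ post pre : List (Fin I), List.finRange I = pre ++ post →
      act ((post.map fun i : Fin I =>
          actOne (unfusedKbar b d (u * q ^ (((I : ℝ) + 1) / 2 - idx i))) i *
            prodInc fun j : Fin I => if i < j then
              actTwo (unfusedR q (u ^ 2 * q ^ ((I : ℝ) + 1 - idx i - idx j)))⁻¹ j i else 1).prod)
        (fun z => φ (word (letter dOp eOp) (pre.map (fun i => (i, (bdry q u i)⁻¹)) ++
            post.map fun i => (i, (bdry q u i)⁻¹)) z)) =
      fun z => φ (word (letter dOp eOp) (pre.map (fun i => (i, (bdry q u i)⁻¹)) ++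
        post.reverse.map fun i => (i, bdry q u i)) z) := by
    intro post
    induction post with
    | nil => intro pre h; simp [act_one]
    | cons i post ih =>
      intro pre h
      have hsort := List.pairwise_lt_finRange I
      have hnd := List.nodup_finRange I
      rw [h] at hsort hnd
      have h0 := ih (pre ++ [i]) (by simpa using h)
      rw [List.map_append, List.append_assoc, List.append_assoc] at h0
      rw [List.map_cons, List.prod_cons, act_mul]
      refine Eq.trans (congrArg _ h0) ?_
      have hfilter : (List.finRange I).filter (fun j => i < j) = post := by
        rw [h]
        simp only [List.pairwise_append, List.pairwise_cons] at hsort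
        rw [List.filter_append]
        have e1 : pre.filter (fun j => decide (i < j)) = [] := by
          rw [List.filter_eq_nil_iff]; grind
        have e2 : post.filter (fun j => decide (i < j)) = post := by
          rw [List.filter_eq_self]; grind
        rw [List.filter_cons, e1, e2]; simp
      rw [prodInc, prod_map_ite, hfilter, act_mul, act_comp]
      have hlt : ∀ j ∈ post, i < j := by
        simp only [List.pairwise_append, List.pairwise_cons] at hsort
        grind
      have hinv : (post.map fun j =>
            actTwo (unfusedR q (u ^ 2 * q ^ ((I : ℝ) + 1 - idx i - idx j)))⁻¹ j i) =
          post.map fun j => localTwo (unfusedR q (bdry q u j * bdry q u i)⁻¹) i j := by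
        refine List.map_congr_left fun j hj => ?_
        rw [← bdry_mul_bdry hq, actTwo_inv_unfusedR
          (mul_ne_zero (bdry_ne_zero hq hu j) (bdry_ne_zero hq hu i)) (hR i j (hlt j hj))
          (hR' i j (hlt j hj)), actTwo_eq_localTwo]
      rw [hinv]
      have h1 := act_prod_move_right (letter dOp eOp) post id (bdry q u) i (bdry q u i)⁻¹
        (fun j => unfusedR q (bdry q u j * bdry q u i)⁻¹)
        (fun j hj o => by
          have e : (bdry q u j * bdry q u i)⁻¹ = (bdry q u i)⁻¹ / bdry q u j := by
            rw [_root_.mul_inv_rev, div_eq_mul_inv]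
          rw [e]
          apply letter_exchange hde (inv_ne_zero (bdry_ne_zero hq hu i)) (bdry_ne_zero hq hu j)
          rw [← e]
          exact hR' i j (hlt j hj))
        (pre.map fun i => (i, (bdry q u i)⁻¹)) [] (by
          simp only [List.append_nil, List.map_append, List.map_map, List.map_cons, id]
          simp only [Function.comp_def, List.map_id']
          simp only [List.nodup_append, List.nodup_cons, List.nodup_reverse, List.mem_reverse,
            List.mem_cons] at hnd ⊢
          exact hnd)
      simp only [List.append_nil, id] at h1
      simp only [List.map_cons, List.map_nil, List.cons_append, List.nil_append]
      rw [h1]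
      have h2 := act_localOne_last φ (letter dOp eOp) (unfusedKbar b d (bdry q u i)) i
        (bdry q u i)⁻¹ (bdry q u i)
        (letter_right_boundary φ hφ (bdry_ne_zero hq hu i) (hD i))
        (L := pre.map (fun i => (i, (bdry q u i)⁻¹)) ++
          post.reverse.map fun i => (i, bdry q u i))
        (by
          simp only [List.map_append, List.map_map, Function.comp_def, List.map_id']
          simp only [List.nodup_append, List.nodup_cons] at hnd
          grind)
      rw [actOne_eq_localOne]
      simpa [bdry] using h2
  change act (fusedKbar I q b d u) (fun p => φ (fusedLetter dOp eOp I q u⁻¹ p)) o = _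
  rw [fusedKbar, act_mul, act_mul, act_comp, fusedWord_exchangeable hq hde (inv_ne_zero hu),
    fusionOpKbar, act_mul]
  have h1 := main (List.finRange I) [] rfl
  have h2 : ((List.finRange I).map fun i => (i, (bdry q u i)⁻¹)) =
      (List.finRange I).map fun i => (i, chain q u⁻¹ i) := by simp only [inv_bdry hq]
  rw [List.map_nil, List.nil_append, List.nil_append, h2] at h1
  rw [prodInc, fusedWord, h1, act_reversal_fusedWord, act_comp]
  rfl

end Fusion

/-! ### Stochastic matrices -/

section Stochastic

variable {m n l m' n' : Type*} [Fintype m] [Fintype n] [Fintype m']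

/-- The entries are nonnegative, and each column sums to one. -/
structure IsColStochastic (B : Matrix m n ℝ) : Prop where
  nonneg : ∀ o i, 0 ≤ B o i
  sum_col : ∀ i, ∑ o, B o i = 1

theorem IsColStochastic.mul {B : Matrix m n ℝ} {C : Matrix n l ℝ} (hB : IsColStochastic B)
    (hC : IsColStochastic C) : IsColStochastic (B * C) where
  nonneg _ _ := Finset.sum_nonneg fun _ _ => mul_nonneg (hB.nonneg _ _) (hC.nonneg _ _)
  sum_col i := by
    simp only [Matrix.mul_apply]
    rw [Finset.sum_comm]
    simp only [← Finset.sum_mul, hB.sum_col, one_mul, hC.sum_col]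

theorem IsColStochastic.one [DecidableEq n] : IsColStochastic (1 : Matrix n n ℝ) where
  nonneg o i := by rw [Matrix.one_apply]; split_ifs <;> norm_num
  sum_col i := by simp [Matrix.one_apply]

theorem IsColStochastic.list_prod [DecidableEq n] {J : Type*} (js : List J) (f : J → Matrix n n ℝ)
    (hf : ∀ j ∈ js, IsColStochastic (f j)) : IsColStochastic (js.map f).prod := by
  induction js with
  | nil => exact .one
  | cons j js ih =>
    rw [List.map_cons, List.prod_cons]
    exact (hf j (by simp)).mul (ih fun k hk => hf k (by simp [hk]))

omit [Fintype n] in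
theorem IsColStochastic.kronecker {B : Matrix m n ℝ} {C : Matrix m' n' ℝ} (hB : IsColStochastic B)
    (hC : IsColStochastic C) : IsColStochastic (B ⊗ₖ C) where
  nonneg o i := mul_nonneg (hB.nonneg _ _) (hC.nonneg _ _)
  sum_col i := by
    simp only [Matrix.kroneckerMap_apply, Fintype.sum_prod_type, ← Finset.mul_sum, hC.sum_col,
      mul_one, hB.sum_col]

theorem IsColStochastic.reindex {B : Matrix m m ℝ} (hB : IsColStochastic B) (e : m ≃ n) :
    IsColStochastic (Matrix.reindex e e B) where
  nonneg o i := hB.nonneg _ _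
  sum_col i := by
    rw [← hB.sum_col (e.symm i)]
    exact Fintype.sum_equiv e.symm _ _ (by simp)

variable {ι S : Type*} [Fintype ι] [DecidableEq ι] [Fintype S] [DecidableEq S]

theorem IsColStochastic.localOne {B : Matrix S S ℝ} (hB : IsColStochastic B) (s : ι) :
    IsColStochastic (localOne B s) where
  nonneg o i := by
    simp only [FusedVertex.localOne, Matrix.of_apply]
    split_ifs
    exacts [hB.nonneg _ _, le_rfl]
  sum_col i := by
    have := sum_localOne B s (fun _ => 1) i
    simpa [hB.sum_col] using this

theorem IsColStochastic.localTwo {B : Matrix (S × S) (S × S) ℝ} (hB : IsColStochastic B) {s t : ι}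
    (hst : s ≠ t) : IsColStochastic (localTwo B s t) where
  nonneg o i := by
    simp only [FusedVertex.localTwo, Matrix.of_apply]
    split_ifs
    exacts [hB.nonneg _ _, le_rfl]
  sum_col i := by
    have := sum_localTwo B hst (fun _ => 1) i
    simp only [mul_one] at this
    rw [this, hB.sum_col]

omit [Fintype m] in
theorem mul_apply_pos {B : Matrix m n ℝ} {C : Matrix n l ℝ} (hB : ∀ o i, 0 ≤ B o i)
    (hC : ∀ o i, 0 ≤ C o i) {o : m} {k : n} {i : l} (h : 0 < B o k) (h' : 0 < C k i) :
    0 < (B * C) o i :=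
  Finset.sum_pos' (fun _ _ => mul_nonneg (hB _ _) (hC _ _)) ⟨k, Finset.mem_univ _, mul_pos h h'⟩

/-- The entries are nonnegative, and those on the diagonal are positive. -/
structure IsLazy (B : Matrix n n ℝ) : Prop where
  nonneg : ∀ o i, 0 ≤ B o i
  diag_pos : ∀ i, 0 < B i i

theorem IsLazy.mul {B C : Matrix n n ℝ} (hB : IsLazy B) (hC : IsLazy C) : IsLazy (B * C) where
  nonneg _ _ := Finset.sum_nonneg fun _ _ => mul_nonneg (hB.nonneg _ _) (hC.nonneg _ _)
  diag_pos i := mul_apply_pos hB.nonneg hC.nonneg (hB.diag_pos i) (hC.diag_pos i)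

theorem IsLazy.list_prod [DecidableEq n] {J : Type*} (js : List J) (f : J → Matrix n n ℝ)
    (hf : ∀ j ∈ js, IsLazy (f j)) : IsLazy (js.map f).prod := by
  induction js with
  | nil => exact ⟨IsColStochastic.one.nonneg, fun i => by simp⟩
  | cons j js ih =>
    rw [List.map_cons, List.prod_cons]
    exact (hf j (by simp)).mul (ih fun k hk => hf k (by simp [hk]))

omit [Fintype S] in
theorem IsLazy.localTwo {B : Matrix (S × S) (S × S) ℝ} (hB : IsLazy B) (s t : ι) :
    IsLazy (localTwo B s t) where
  nonneg o i := by
    simp only [FusedVertex.localTwo, Matrix.of_apply]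
    split_ifs
    exacts [hB.nonneg _ _, le_rfl]
  diag_pos i := by
    simpa [FusedVertex.localTwo] using hB.diag_pos _

/-- If each factor can set its own site to `a`, then the product can set all sites to `a`. -/
theorem list_prod_apply_const_pos (f : ι → Matrix (ι → S) (ι → S) ℝ)
    (hf : ∀ i o z, 0 ≤ f i o z) (a : S) (hpos : ∀ i z, 0 < f i (Function.update z i a) z)
    (js : List ι) (hjs : ∀ i, i ∈ js) (z : ι → S) : 0 < (js.map f).prod (fun _ => a) z := by
  have main : ∀ js : List ι, (∀ o i, 0 ≤ (js.map f).prod o i) ∧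
      0 < (js.map f).prod (fun i => if i ∈ js then a else z i) z := by
    intro js
    induction js with
    | nil => exact ⟨IsColStochastic.one.nonneg, by simp⟩
    | cons j js ih =>
      rw [List.map_cons, List.prod_cons]
      refine ⟨fun _ _ => Finset.sum_nonneg fun _ _ => mul_nonneg (hf _ _ _) (ih.1 _ _), ?_⟩
      refine mul_apply_pos (hf j) ih.1 ?_ ih.2
      have := hpos j (fun i => if i ∈ js then a else z i)
      convert this using 2
      funext i
      by_cases h : i = j
      · subst h; simp
      · simp [h]
  simpa [hjs] using (main js).2

end Stochastic

/-! ### Conserved quantities -/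

section Conserved

variable {m n l ι : Type*} [Fintype n]

/-- The matrix maps basis vectors of charge `g` to combinations of basis vectors of equal charge. -/
def Conserves (f : m → ℕ) (g : n → ℕ) (B : Matrix m n ℝ) : Prop := ∀ o i, B o i ≠ 0 → f o = g i

theorem Conserves.mul {f : m → ℕ} {g : n → ℕ} {h : l → ℕ} {B : Matrix m n ℝ} {C : Matrix n l ℝ}
    (hB : Conserves f g B) (hC : Conserves g h C) : Conserves f h (B * C) := by
  intro o i hoi
  obtain ⟨k, -, hk⟩ := Finset.exists_ne_zero_of_sum_ne_zero hoi
  exact (hB o k (left_ne_zero_of_mul hk)).trans (hC k i (right_ne_zero_of_mul hk))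

theorem Conserves.list_prod [DecidableEq n] {f : n → ℕ} {J : Type*} (js : List J)
    (B : J → Matrix n n ℝ) (hB : ∀ j ∈ js, Conserves f f (B j)) :
    Conserves f f (js.map B).prod := by
  induction js with
  | nil =>
    intro o i h
    by_cases hoi : o = i
    · rw [hoi]
    · exact absurd (Matrix.one_apply_ne hoi) h
  | cons j js ih =>
    rw [List.map_cons, List.prod_cons]
    exact (hB j (by simp)).mul (ih fun k hk => hB k (by simp [hk]))

theorem Conserves.localTwo [Fintype ι] [DecidableEq ι]
    {B : Matrix (Fin 2 × Fin 2) (Fin 2 × Fin 2) ℝ}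
    (hB : Conserves (fun p => (p.1 : ℕ) + p.2) (fun p => (p.1 : ℕ) + p.2) B) {s t : ι}
    (hst : s ≠ t) :
    Conserves (fun z => ∑ i, (z i : ℕ)) (fun z => ∑ i, (z i : ℕ)) (localTwo B s t) := by
  intro o i h
  simp only [FusedVertex.localTwo, Matrix.of_apply, ne_eq, ite_eq_right_iff, not_forall] at h
  obtain ⟨hoff, h⟩ := h
  have h1 := hB _ _ h
  -- A balance at each site, with the two affected sites compensated additively to avoid subtraction
  -- in `ℕ`.
  have h2 : ∀ k, (o k : ℕ) + ((if k = s then (i s : ℕ) else 0) + if k = t then (i t : ℕ) else 0) =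
      i k + ((if k = s then (o s : ℕ) else 0) + if k = t then (o t : ℕ) else 0) := by
    intro k
    by_cases hs : k = s
    · subst hs; simp [hst]; omega
    · by_cases ht : k = t
      · subst ht; simp [hs]; omega
      · simp [hs, ht, hoff k hs ht]
  have h3 := Finset.sum_congr rfl fun k (_ : k ∈ Finset.univ) => h2 k
  simp only [Finset.sum_add_distrib, Finset.sum_ite_eq', Finset.mem_univ, if_true] at h3
  simp only at h1
  change ∑ k, (o k : ℕ) = ∑ k, (i k : ℕ)
  omega

end Conserved

/-! ### Positivity of the unfused and of the fused weights -/

theorem unfusedR_lazy {q u : ℝ} (hq0 : 0 < q) (hq1 : q < 1) (hu0 : 0 < u) (hu1 : u < 1) :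
    IsLazy (unfusedR q u) := by
  have h1 : 0 < 1 - q := by linarith
  have h2 : 0 < 1 - u := by linarith
  have h3 : 0 < 1 - q * u := by nlinarith
  refine ⟨fun o i => ?_, fun i => ?_⟩
  · rw [unfusedR_apply]
    split_ifs <;> positivity
  · rw [unfusedR_apply]
    split_ifs <;> first | positivity | exact absurd rfl ‹¬ _ = _›

theorem unfusedR_stochastic {q u : ℝ} (hq0 : 0 < q) (hq1 : q < 1) (hu0 : 0 < u) (hu1 : u < 1) :
    IsColStochastic (unfusedR q u) := by
  refine ⟨(unfusedR_lazy hq0 hq1 hu0 hu1).nonneg, fun i => ?_⟩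
  have h3 : 1 - q * u ≠ 0 := by nlinarith
  obtain ⟨i, j⟩ := i
  simp only [Fintype.sum_prod_type, Fin.sum_univ_two, unfusedR_apply]
  fin_cases i <;> fin_cases j <;> simp <;> rw [← add_div, div_eq_one_iff_eq h3] <;> ring

theorem unfusedR_conserves (q u : ℝ) :
    Conserves (fun p => (p.1 : ℕ) + p.2) (fun p => (p.1 : ℕ) + p.2) (unfusedR q u) := by
  rintro ⟨o1, o2⟩ ⟨i1, i2⟩ h
  rw [unfusedR_apply] at h
  split_ifs at h with h1 h2 h3 h4 h5 h6 <;> simp_all [add_comm]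

/-- The common denominator and all four numerators are negative, because `(a - c) u > 1` and `u < 1`
give `a - c > 1 > u`. -/
theorem unfusedK_pos {a c u : ℝ} (ha : 0 < a) (hc : 0 < c) (hu0 : 0 < u) (hu1 : u < 1)
    (hac : 1 < (a - c) * u) (o i : Fin 2) : 0 < unfusedK a c u o i := by
  have h0 : 1 < a - c := by nlinarith
  have hD : c * u ^ 2 + u - a < 0 := by
    linarith [mul_le_of_le_one_right hc.le (pow_le_one₀ (n := 2) hu0.le hu1.le)]
  have h1 : u ^ 2 - 1 < 0 := by nlinarith
  fin_cases o <;> fin_cases i <;> simp only [unfusedK] <;> simp <;> apply div_pos_of_neg_of_neg <;>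
    nlinarith

theorem unfusedK_stochastic {a c u : ℝ} (ha : 0 < a) (hc : 0 < c) (hu0 : 0 < u) (hu1 : u < 1)
    (hac : 1 < (a - c) * u) : IsColStochastic (unfusedK a c u) := by
  refine ⟨fun o i => (unfusedK_pos ha hc hu0 hu1 hac o i).le, fun i => ?_⟩
  have h0 : 1 < a - c := by nlinarith
  have hD : c * u ^ 2 + u - a ≠ 0 := by
    refine ne_of_lt ?_
    linarith [mul_le_of_le_one_right hc.le (pow_le_one₀ (n := 2) hu0.le hu1.le)]
  fin_cases i <;> simp [unfusedK] <;> rw [← add_div, div_eq_one_iff_eq hD] <;> ring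

/-- Here the common denominator and all four numerators are positive: `1 < u < b - d`. -/
theorem unfusedKbar_pos {b d u : ℝ} (hb : 0 < b) (hd : 0 < d) (hu1 : 1 < u)
    (hbd : u < b - d) (o i : Fin 2) : 0 < unfusedKbar b d u o i := by
  have h1 : 0 < u ^ 2 - 1 := by nlinarith
  have h2 : 0 < (b - d) * u ^ 2 - u := by nlinarith [mul_pos (sub_pos.2 hu1) (sub_pos.2 hbd)]
  have hD : 0 < b * u ^ 2 - u - d := by nlinarith [mul_pos hd h1]
  have h3 : 0 < b - d - u := by linarith
  fin_cases o <;> fin_cases i <;> simp only [unfusedKbar] <;> simp <;> positivity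

theorem unfusedKbar_stochastic {b d u : ℝ} (hb : 0 < b) (hd : 0 < d) (hu1 : 1 < u)
    (hbd : u < b - d) : IsColStochastic (unfusedKbar b d u) := by
  refine ⟨fun o i => (unfusedKbar_pos hb hd hu1 hbd o i).le, fun i => ?_⟩
  have h2 : 0 < (b - d) * u ^ 2 - u := by nlinarith [mul_pos (sub_pos.2 hu1) (sub_pos.2 hbd)]
  have hD : b * u ^ 2 - u - d ≠ 0 := by
    refine ne_of_gt ?_
    nlinarith [mul_pos hd (show 0 < u ^ 2 - 1 by nlinarith)]
  fin_cases i <;> simp [unfusedKbar] <;> rw [← add_div, div_eq_one_iff_eq hD] <;> ring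

theorem exists_total_eq {I j : ℕ} (h : j ≤ I) : ∃ z : Fin I → Fin 2, total z = j := by
  induction I generalizing j with
  | zero => exact ⟨fun _ => 0, by simp [total]; omega⟩
  | succ I ih =>
    rcases Nat.lt_or_ge I j with h1 | h1
    · obtain ⟨z, hz⟩ := ih (j := I) le_rfl
      exact ⟨Fin.cons 1 z, by rw [total_cons, hz]; simp; omega⟩
    · obtain ⟨z, hz⟩ := ih h1
      exact ⟨Fin.cons 0 z, by rw [total_cons, hz]; simp⟩

theorem proj_stochastic (I : ℕ) : IsColStochastic (proj I) where
  nonneg o i := by simp only [proj, Matrix.of_apply]; split_ifs <;> norm_num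
  sum_col z := by
    have : ∀ j : Fin (I + 1), (total z = (j : ℕ)) ↔ j = ⟨total z, Nat.lt_succ_of_le (total_le z)⟩ :=
      fun j => by rw [Fin.ext_iff]; exact eq_comm
    simp [proj, this]

theorem incl_stochastic {I : ℕ} {q : ℝ} (hq : 0 < q) : IsColStochastic (incl I q) where
  nonneg z j := by
    simp only [incl, Matrix.of_apply]
    split_ifs with h
    · have := partitionZ_pos hq z
      rw [h] at this
      positivity
    · rfl
  sum_col j := by
    obtain ⟨z, hz⟩ := exists_total_eq (Nat.le_of_lt_succ j.2)
    have := partitionZ_pos hq z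
    rw [hz] at this
    rw [← div_self this.ne']
    conv_rhs => rw [partitionZ]
    rw [Finset.sum_div]
    refine Finset.sum_congr rfl fun w _ => ?_
    simp only [incl, Matrix.of_apply]
    split_ifs
    · rfl
    · simp

theorem incl_pos {I : ℕ} {q : ℝ} (hq : 0 < q) {z : Fin I → Fin 2} {j : Fin (I + 1)}
    (h : total z = j) : 0 < incl I q z j := by
  have := partitionZ_pos hq z
  rw [h] at this
  simp only [incl, Matrix.of_apply, if_pos h]
  positivity

theorem proj_pos {I : ℕ} {z : Fin I → Fin 2} {j : Fin (I + 1)}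
    (h : total z = j) : 0 < proj I j z := by
  simp [proj, h]

theorem reversal_stochastic (I : ℕ) : IsColStochastic (reversal I) where
  nonneg o i := by simp only [reversal, Matrix.of_apply]; split_ifs <;> norm_num
  sum_col z := by simp [reversal]

/-! ### Stochasticity and positive entries of the fused matrices -/

section Fused

variable {I : ℕ} {q : ℝ}

theorem fusedR_stochastic {u : ℝ} (hq0 : 0 < q) (hq1 : q < 1)
    (hu0 : ∀ i j : Fin I, 0 < u * q ^ (idx j - idx i))
    (hu1 : ∀ i j : Fin I, u * q ^ (idx j - idx i) < 1) : IsColStochastic (fusedR I q u) :=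
  (((proj_stochastic I).kronecker (proj_stochastic I)).mul
    (IsColStochastic.reindex (.list_prod _ _ fun a _ => .list_prod _ _ fun b _ =>
      (unfusedR_stochastic hq0 hq1 (hu0 a b) (hu1 a b)).localTwo (by simp)) _)).mul
    ((incl_stochastic hq0).kronecker (incl_stochastic hq0))

/-- `Π̂` reaches some pair of words with the given totals, each `R` factor leaves it in place with
positive weight, and `Π` returns to `p`. -/
theorem fusedR_diag_pos {u : ℝ} (hq0 : 0 < q) (hq1 : q < 1)
    (hu0 : ∀ i j : Fin I, 0 < u * q ^ (idx j - idx i))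
    (hu1 : ∀ i j : Fin I, u * q ^ (idx j - idx i) < 1) (p : Fin (I + 1) × Fin (I + 1)) :
    0 < fusedR I q u p p := by
  have hP := (proj_stochastic I).kronecker (proj_stochastic I)
  have hF : IsColStochastic (Matrix.reindex (Equiv.sumArrowEquivProdArrow (Fin I) (Fin I) (Fin 2))
      (Equiv.sumArrowEquivProdArrow (Fin I) (Fin I) (Fin 2)) (fusionOpR I q u)) :=
    IsColStochastic.reindex (.list_prod _ _ fun a _ => .list_prod _ _ fun b _ =>
      (unfusedR_stochastic hq0 hq1 (hu0 a b) (hu1 a b)).localTwo (by simp)) _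
  have hL : IsLazy (fusionOpR I q u) :=
    .list_prod _ _ fun a _ => .list_prod _ _ fun b _ =>
      (unfusedR_lazy hq0 hq1 (hu0 a b) (hu1 a b)).localTwo _ _
  obtain ⟨z, hz⟩ := exists_total_eq (Nat.le_of_lt_succ p.1.2)
  obtain ⟨w, hw⟩ := exists_total_eq (Nat.le_of_lt_succ p.2.2)
  refine mul_apply_pos (k := (z, w)) (hP.mul hF).nonneg
    ((incl_stochastic hq0).kronecker (incl_stochastic hq0)).nonneg
    (mul_apply_pos (k := (z, w)) hP.nonneg hF.nonneg ?_ (hL.diag_pos _)) ?_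
  · exact mul_pos (proj_pos hz) (proj_pos hw)
  · exact mul_pos (incl_pos hq0 hz) (incl_pos hq0 hw)

theorem fusedR_conserves (u : ℝ) : Conserves (fun p => (p.1 : ℕ) + p.2)
    (fun p => (p.1 : ℕ) + p.2) (fusedR I q u) := by
  refine Conserves.mul (g := fun p => total p.1 + total p.2)
    (Conserves.mul (g := fun p => total p.1 + total p.2) ?_ ?_) ?_
  · intro o p h
    simp only [Matrix.kroneckerMap_apply, proj, Matrix.of_apply, ne_eq, mul_eq_zero, not_or,
      ite_eq_right_iff, not_forall] at h
    obtain ⟨⟨h1, -⟩, h2, -⟩ := h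
    simp only [h1, h2]
  · intro o p h
    have h1 : Conserves (fun z => ∑ i, (z i : ℕ)) (fun z => ∑ i, (z i : ℕ)) (fusionOpR I q u) :=
      .list_prod _ _ fun a _ => .list_prod _ _ fun b _ =>
        (unfusedR_conserves q _).localTwo (by simp)
    have h2 := h1 _ _ h
    simp only [Fintype.sum_sum_type] at h2
    exact h2
  · intro p o h
    simp only [Matrix.kroneckerMap_apply, incl, Matrix.of_apply, ne_eq, mul_eq_zero, not_or,
      ite_eq_right_iff, not_forall] at h
    obtain ⟨⟨h1, -⟩, h2, -⟩ := h
    simp only [h1, h2]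

/-- A product of stochastic matrices, reversed and fused. -/
theorem fused_stochastic (hq0 : 0 < q) (js : List (Fin I))
    (f : Fin I → Matrix (Fin I → Fin 2) (Fin I → Fin 2) ℝ) (hf : ∀ i, IsColStochastic (f i)) :
    IsColStochastic (proj I * (reversal I * (js.map f).prod) * incl I q) :=
  ((proj_stochastic I).mul ((reversal_stochastic I).mul (.list_prod _ _ fun i _ => hf i))).mul
    (incl_stochastic hq0)

/-- Starting from any word on level `j`, the factors set the sites to zero one after the other; the
zero word is fixed by the reversal and is projected to `0`. -/
theorem fused_apply_zero_pos (hq0 : 0 < q) (js : List (Fin I)) (hjs : ∀ i, i ∈ js)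
    (f : Fin I → Matrix (Fin I → Fin 2) (Fin I → Fin 2) ℝ) (hf : ∀ i, IsColStochastic (f i))
    (hpos : ∀ i z, 0 < f i (Function.update z i 0) z) (j : Fin (I + 1)) :
    0 < (proj I * (reversal I * (js.map f).prod) * incl I q) 0 j := by
  obtain ⟨z, hz⟩ := exists_total_eq (Nat.le_of_lt_succ j.2)
  have hP := proj_stochastic I
  have hV := reversal_stochastic I
  have hF : IsColStochastic (js.map f).prod := .list_prod _ _ fun i _ => hf i
  refine mul_apply_pos (k := z) (hP.mul (hV.mul hF)).nonneg (incl_stochastic hq0).nonneg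
    (mul_apply_pos (k := fun _ => 0) hP.nonneg (hV.mul hF).nonneg (proj_pos (by simp [total]))
      (mul_apply_pos (k := fun _ => 0) hV.nonneg hF.nonneg ?_
        (list_prod_apply_const_pos f (fun i => (hf i).nonneg) 0 hpos js hjs z)))
    (incl_pos hq0 hz)
  simp only [reversal, Matrix.of_apply]
  rw [if_pos (by funext i; rfl)]
  norm_num

theorem localOne_update_pos {B : Matrix (Fin 2) (Fin 2) ℝ} (hB : ∀ o i, 0 < B o i) (i : Fin I)
    (z : Fin I → Fin 2) (a : Fin 2) : 0 < localOne B i (Function.update z i a) z := by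
  simp only [localOne, Matrix.of_apply]
  rw [if_pos (by intro k hk; simp [hk])]
  exact hB _ _

theorem list_prod_ite_stochastic_lazy (js : List (Fin I)) (p : Fin I → Prop) [DecidablePred p]
    (B : Fin I → Matrix (Fin I → Fin 2) (Fin I → Fin 2) ℝ)
    (hB : ∀ j, p j → IsColStochastic (B j) ∧ IsLazy (B j)) :
    IsColStochastic (js.map fun j => if p j then B j else 1).prod ∧
      IsLazy (js.map fun j => if p j then B j else 1).prod := by
  rw [prod_map_ite]
  exact ⟨.list_prod _ _ fun j hj => (hB j (by simpa using (List.mem_filter.1 hj).2)).1,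
    .list_prod _ _ fun j hj => (hB j (by simpa using (List.mem_filter.1 hj).2)).2⟩

theorem fusedK_stochastic_pos {a c u : ℝ} (hq0 : 0 < q) (hq1 : q < 1) (ha : 0 < a) (hc : 0 < c)
    (hu0 : ∀ i : Fin I, 0 < bdry q u i) (hu1 : ∀ i : Fin I, bdry q u i < 1)
    (hac : ∀ i : Fin I, 1 < (a - c) * bdry q u i) :
    IsColStochastic (fusedK I q a c u) ∧ ∀ j, 0 < fusedK I q a c u 0 j := by
  have hR : ∀ i : Fin I, _ := fun i =>
    list_prod_ite_stochastic_lazy (List.finRange I).reverse (fun j => j < i)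
      (fun j => actTwo (unfusedR q (u ^ 2 * q ^ ((I : ℝ) + 1 - idx i - idx j))) j i)
      (fun j hj => by
        rw [← bdry_mul_bdry hq0]
        have h1 := mul_pos (hu0 j) (hu0 i)
        have h2 := mul_lt_one_of_nonneg_of_lt_one_left (hu0 j).le (hu1 j) (hu1 i).le
        exact ⟨(unfusedR_stochastic hq0 hq1 h1 h2).localTwo hj.ne,
          (unfusedR_lazy hq0 hq1 h1 h2).localTwo _ _⟩)
  have hK : ∀ i : Fin I, IsColStochastic (localOne (unfusedK a c (bdry q u i)) i) := fun i =>
    (unfusedK_stochastic ha hc (hu0 i) (hu1 i) (hac i)).localOne i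
  refine ⟨fused_stochastic hq0 _ _ fun i => (hK i).mul (hR i).1,
    fused_apply_zero_pos hq0 _ (by simp) _ (fun i => (hK i).mul (hR i).1) fun i z => ?_⟩
  -- The `R` factors do not change `z` with positive weight, and `K_i` then sets site `i` to zero.
  exact mul_apply_pos (hK i).nonneg (hR i).1.nonneg
    (localOne_update_pos (unfusedK_pos ha hc (hu0 i) (hu1 i) (hac i)) i z 0) ((hR i).2.diag_pos z)

theorem fusedKbar_stochastic_pos {b d u : ℝ} (hq0 : 0 < q) (hq1 : q < 1) (hb : 0 < b) (hd : 0 < d)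
    (hu1 : ∀ i : Fin I, 1 < bdry q u i) (hbd : ∀ i : Fin I, bdry q u i < b - d)
    (hR : ∀ i j : Fin I, i < j → 1 - q * (bdry q u j * bdry q u i) ≠ 0) :
    IsColStochastic (fusedKbar I q b d u) ∧ ∀ j, 0 < fusedKbar I q b d u 0 j := by
  have hR : ∀ i : Fin I, _ := fun i =>
    list_prod_ite_stochastic_lazy (List.finRange I) (fun j => i < j)
      (fun j => actTwo (unfusedR q (u ^ 2 * q ^ ((I : ℝ) + 1 - idx i - idx j)))⁻¹ j i)
      (fun j hj => by
        rw [← bdry_mul_bdry hq0]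
        have h0 : 1 < bdry q u j * bdry q u i := one_lt_mul (hu1 j).le (hu1 i)
        have h1 : 0 < (bdry q u j * bdry q u i)⁻¹ := by positivity
        have h2 := inv_lt_one_of_one_lt₀ h0
        rw [actTwo_inv_unfusedR (by positivity) (hR i j hj) (by nlinarith)]
        exact ⟨(unfusedR_stochastic hq0 hq1 h1 h2).localTwo hj.ne,
          (unfusedR_lazy hq0 hq1 h1 h2).localTwo _ _⟩)
  have hK : ∀ i : Fin I, IsColStochastic (localOne (unfusedKbar b d (bdry q u i)) i) := fun i =>
    (unfusedKbar_stochastic hb hd (hu1 i) (hbd i)).localOne i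
  refine ⟨fused_stochastic hq0 _ _ fun i => (hK i).mul (hR i).1,
    fused_apply_zero_pos hq0 _ (by simp) _ (fun i => (hK i).mul (hR i).1) fun i z => ?_⟩
  exact mul_apply_pos (hK i).nonneg (hR i).1.nonneg
    (localOne_update_pos (unfusedKbar_pos hb hd (hu1 i) (hbd i)) i z 0) ((hR i).2.diag_pos z)

end Fused

/-! ### Uniqueness of the stationary measure -/

section Markov

variable {S : Type*} [Fintype S] {T : Matrix S S ℝ}

/-- The triangle inequality gives `≤` at each state with `|x|` on the smaller side. As the row sums
of `T` are one, both sides have the same total, so equality holds at each state. -/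
theorem abs_stationary (hT : ∀ s s', 0 ≤ T s s') (hT1 : ∀ s, ∑ s', T s s' = 1) {x : S → ℝ}
    (hx : ∀ s', ∑ s, T s s' * x s = x s') (s' : S) : ∑ s, T s s' * |x s| = |x s'| := by
  have hle : ∀ s' ∈ Finset.univ, |x s'| ≤ ∑ s, T s s' * |x s| := by
    intro s' _
    rw [← hx s']
    refine (Finset.abs_sum_le_sum_abs _ _).trans_eq (Finset.sum_congr rfl fun s _ => ?_)
    rw [abs_mul, abs_of_nonneg (hT s s')]
  have hsum : ∑ s', |x s'| = ∑ s', ∑ s, T s s' * |x s| := by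
    rw [Finset.sum_comm]
    simp only [← Finset.sum_mul, hT1, one_mul]
  exact ((Finset.sum_eq_sum_iff_of_le hle).1 hsum s' (Finset.mem_univ _)).symm

/-- Zeros of a nonnegative invariant vector propagate backwards along positive transitions. The
potential `Φ` ensures that following such transitions ends at `s₀`, though not necessarily in one
step. -/
theorem eq_zero_of_stationary_nonneg (hT : ∀ s s', 0 ≤ T s s') (s₀ : S) (Φ : S → ℕ)
    (hΦ : ∀ s, s ≠ s₀ → ∃ s', 0 < T s s' ∧ Φ s' < Φ s) {x : S → ℝ}
    (hx : ∀ s', ∑ s, T s s' * x s = x s') (hx0 : ∀ s, 0 ≤ x s) (h0 : x s₀ = 0) (s : S) :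
    x s = 0 := by
  induction hn : Φ s using Nat.strong_induction_on generalizing s with
  | _ n ih =>
    by_cases hs : s = s₀
    · rw [hs, h0]
    · obtain ⟨s', hpos, hlt⟩ := hΦ s hs
      have h1 := ih (Φ s') (hn ▸ hlt) s' rfl
      rw [← hx s', Finset.sum_eq_zero_iff_of_nonneg
        fun r _ => mul_nonneg (hT _ _) (hx0 r)] at h1
      exact (mul_eq_zero.1 (h1 s (Finset.mem_univ _))).resolve_left hpos.ne'

theorem nonneg_of_stationary (hT : ∀ s s', 0 ≤ T s s') (hT1 : ∀ s, ∑ s', T s s' = 1) (s₀ : S)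
    (Φ : S → ℕ) (hΦ : ∀ s, s ≠ s₀ → ∃ s', 0 < T s s' ∧ Φ s' < Φ s) {x : S → ℝ}
    (hx : ∀ s', ∑ s, T s s' * x s = x s') (h0 : 0 ≤ x s₀) (s : S) : 0 ≤ x s := by
  -- Both `|x|` and `x` are invariant, so `|x| - x` is nonnegative, invariant, and zero at `s₀`.
  have h := eq_zero_of_stationary_nonneg hT s₀ Φ hΦ (x := fun s => |x s| - x s)
    (fun s' => by simp only [mul_sub, Finset.sum_sub_distrib, hx, abs_stationary hT hT1 hx])
    (fun s => sub_nonneg.2 (le_abs_self _)) (by simp [abs_of_nonneg h0]) s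
  rw [← sub_eq_zero.1 h]
  exact abs_nonneg _

theorem eq_zero_of_stationary (hT : ∀ s s', 0 ≤ T s s') (hT1 : ∀ s, ∑ s', T s s' = 1) (s₀ : S)
    (Φ : S → ℕ) (hΦ : ∀ s, s ≠ s₀ → ∃ s', 0 < T s s' ∧ Φ s' < Φ s) {x : S → ℝ}
    (hx : ∀ s', ∑ s, T s s' * x s = x s') (hsum : ∑ s, x s = 0) (s : S) : x s = 0 := by
  rcases le_total 0 (x s₀) with h | h
  · exact (Finset.sum_eq_zero_iff_of_nonneg
      fun s _ => nonneg_of_stationary hT hT1 s₀ Φ hΦ hx h s).1 hsum s (Finset.mem_univ _)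
  · have h1 := nonneg_of_stationary hT hT1 s₀ Φ hΦ (x := fun s => -x s)
      (fun s' => by simp [hx]) (by simpa using h)
    have h2 := (Finset.sum_eq_zero_iff_of_nonneg fun s _ => h1 s).1 (by simp [hsum]) s
      (Finset.mem_univ _)
    simpa using h2

/-- A complex invariant vector with nonzero sum is proportional to the unique stationary
probability measure, if a given state can be reached from everywhere. -/
theorem exists_unique_stationary (hT : ∀ s s', 0 ≤ T s s') (hT1 : ∀ s, ∑ s', T s s' = 1) (s₀ : S)
    (Φ : S → ℕ) (hΦ : ∀ s, s ≠ s₀ → ∃ s', 0 < T s s' ∧ Φ s' < Φ s) {v : S → ℂ}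
    (hv : ∀ s', ∑ s, T s s' • v s = v s') (hsum : ∑ s, v s ≠ 0) :
    ∃ μ : S → ℝ, (∀ s, (μ s : ℂ) = v s / ∑ s, v s) ∧ IsStationaryMeasure T μ ∧
      ∀ ν, IsStationaryMeasure T ν → ν = μ := by
  set Z := ∑ s, v s with hZ
  have hw : ∀ s', ∑ s, T s s' • (v s / Z) = v s' / Z := by
    intro s'
    rw [← hv s', Finset.sum_div]
    refine Finset.sum_congr rfl fun s _ => ?_
    rw [smul_div_assoc]
  have hw1 : ∑ s, v s / Z = 1 := by rw [← Finset.sum_div, div_self hsum]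
  have him : ∀ s, (v s / Z).im = 0 := by
    refine eq_zero_of_stationary hT hT1 s₀ Φ hΦ (fun s' => ?_) ?_
    · have := congrArg Complex.im (hw s')
      simpa only [Complex.im_sum, Complex.smul_im, smul_eq_mul] using this
    · have := congrArg Complex.im hw1
      simpa only [Complex.im_sum, Complex.one_im] using this
  have hre : ∀ s', ∑ s, T s s' * (v s / Z).re = (v s' / Z).re := by
    intro s'
    have := congrArg Complex.re (hw s')
    simpa only [Complex.re_sum, Complex.smul_re, smul_eq_mul] using this
  have hre1 : ∑ s, (v s / Z).re = 1 := by
    have := congrArg Complex.re hw1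
    simpa only [Complex.re_sum, Complex.one_re] using this
  refine ⟨fun s => (v s / Z).re, fun s => ?_, ⟨fun s => ?_, hre1, hre⟩, fun ν hν => ?_⟩
  · apply Complex.ext
    · simp
    · rw [him s]; simp
  · refine nonneg_of_stationary hT hT1 s₀ Φ hΦ hre ?_ s
    -- A negative value at `s₀` would make the whole real part nonpositive, against its sum `1`.
    by_contra h
    have h1 := nonneg_of_stationary hT hT1 s₀ Φ hΦ (x := fun s => -(v s / Z).re)
      (fun s' => by simp [hre]) (by linarith)
    have h2 := Finset.sum_nonneg fun s (_ : s ∈ Finset.univ) => h1 s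
    rw [Finset.sum_neg_distrib, hre1] at h2
    linarith
  · funext s
    refine sub_eq_zero.1 (eq_zero_of_stationary hT hT1 s₀ Φ hΦ
      (x := fun s => ν s - (v s / Z).re) (fun s' => ?_) ?_ s)
    · simp only [mul_sub, Finset.sum_sub_distrib, hre, hν.stationary]
    · simp only [Finset.sum_sub_distrib, hre1, hν.sum_eq_one, sub_self]

end Markov

/-! ### Down-right paths by their heights -/

section Strip

variable {N I : ℕ}

/-- The `i`-th outgoing edge of the path whose `k`-th vertex is `(h k + k, h k)`. -/
def edgeOf (h : ℕ → ℕ) (i : Fin N) : Edge :=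
  if h (i + 1) = h i then ((h i + i + 1, h i + 1), Dir.up) else ((h i + i + 1, h i), Dir.right)

/-- The direction of the `i`-th outgoing edge of the path with heights `h`. -/
def dirOf (h : ℕ → ℕ) (i : Fin N) : Dir := if h (i + 1) = h i then Dir.up else Dir.right

theorem edgeOf_injective (h : ℕ → ℕ) : Function.Injective (edgeOf h : Fin N → Edge) := by
  intro i j hij
  unfold edgeOf at hij
  split_ifs at hij <;> simp only [Prod.mk.injEq, reduceCtorEq, and_true, and_false] at hij <;>
    (ext; omega)

/-- The vertex on the `k`-th diagonal next to the path is entered by two edges of the path. -/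
def Flippable (N : ℕ) (h : ℕ → ℕ) (k : ℕ) : Prop :=
  (k ≠ 0 → h (k - 1) = h k + 1) ∧ (k < N → h (k + 1) = h k)

/-- A list of diagonals at which the path with heights `h` can be raised successively, with the
vertices that are passed and the final heights. -/
inductive FlipChain (N : ℕ) : (ℕ → ℕ) → List (Fin (N + 1)) → List (ℕ × ℕ) → (ℕ → ℕ) → Prop
  | nil (h : ℕ → ℕ) : FlipChain N h [] [] h
  | cons {h h' : ℕ → ℕ} {k : Fin (N + 1)} {ks : List (Fin (N + 1))} {vs : List (ℕ × ℕ)} :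
      Flippable N h k → FlipChain N (Function.update h k (h k + 1)) ks vs h' →
      FlipChain N h (k :: ks) ((h k + 1 + k, h k + 1) :: vs) h'

/-- The heights after raising the path at the diagonals in a list. -/
def raise (h : ℕ → ℕ) (ks : List (Fin (N + 1))) (k : ℕ) : ℕ :=
  h k + if ∃ j ∈ ks, (j : ℕ) = k then 1 else 0

/-- The diagonals are raised by increasing height, ties from left to right. When the turn comes to
`k`, a left neighbour of equal height has been raised and one that is higher has not, so it is at `h
k + 1`. A right neighbour of equal height has not been raised and a lower one has, so it is at `h
k`. These are the two conditions in `Flippable`. -/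
theorem flipChain_raise {h : ℕ → ℕ} (hh : ∀ k < N, h (k + 1) = h k ∨ h (k + 1) + 1 = h k)
    (l pre : List (Fin (N + 1)))
    (hpw : (pre ++ l).Pairwise fun j k : Fin (N + 1) => h j < h k ∨ (h j = h k ∧ j < k))
    (hmem : ∀ k, k ∈ pre ++ l) :
    FlipChain N (raise h pre) l (l.map fun k : Fin (N + 1) => (h k + 1 + k, h k + 1)) (raise h (pre ++ l)) := by
  induction l generalizing pre with
  | nil => rw [List.append_nil]; exact .nil _
  | cons k l ih =>
    have h1 := ih (pre ++ [k]) (by simpa using hpw) (by simpa using hmem)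
    rw [List.pairwise_append, List.pairwise_cons] at hpw
    obtain ⟨-, ⟨hkl, -⟩, hpre⟩ := hpw
    have hk : k ∉ pre := fun hk => by
      have := hpre k hk k (by simp)
      simp at this
    have hval : ∀ j : Fin (N + 1), (∃ i ∈ pre, (i : ℕ) = j) ↔ j ∈ pre := fun j =>
      ⟨by rintro ⟨i, hi, hij⟩; rwa [← Fin.ext hij], fun hj => ⟨j, hj, rfl⟩⟩
    have hrk : raise h pre k = h k := by simp only [raise, hval, if_neg hk, add_zero]
    have hr : ∀ j : Fin (N + 1), raise h pre j = if j ∈ pre then h j + 1 else h j := by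
      intro j
      simp only [raise, hval]
      split_ifs <;> rfl
    have hmem' : ∀ j, j ≠ k → j ∉ pre → (h k < h j ∨ (h k = h j ∧ k < j)) := by
      intro j hj hj'
      have := hmem j
      rw [List.mem_append, List.mem_cons] at this
      exact hkl j (by tauto)
    have hflip : Flippable N (raise h pre) k := by
      rw [Flippable, hrk]
      constructor
      · intro hk0
        have hj : ((⟨k - 1, by omega⟩ : Fin (N + 1)) : ℕ) = k - 1 := rfl
        rw [← hj, hr]
        have h2 := hh (k - 1) (by omega)
        rw [Nat.sub_add_cancel (by omega)] at h2
        split_ifs with hm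
        · have := hpre _ hm k (by simp)
          simp only at this ⊢
          omega
        · have := hmem' _ (by rw [Ne, Fin.ext_iff]; simp only; omega) hm
          simp only [Fin.lt_def] at this ⊢
          omega
      · intro hkN
        have hj : ((⟨k + 1, by omega⟩ : Fin (N + 1)) : ℕ) = k + 1 := rfl
        rw [← hj, hr]
        have h2 := hh k hkN
        split_ifs with hm
        · have := hpre _ hm k (by simp)
          simp only [Fin.lt_def] at this ⊢
          omega
        · have := hmem' _ (by rw [Ne, Fin.ext_iff]; simp only; omega) hm
          simp only [Fin.lt_def] at this ⊢
          omega
    have hupd : Function.update (raise h pre) k (raise h pre k + 1) = raise h (pre ++ [k]) := by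
      funext j
      by_cases hjk : j = k
      · subst hjk
        rw [Function.update_self, hrk, raise, if_pos ⟨k, by simp, rfl⟩]
      · rw [Function.update_of_ne hjk]
        simp only [raise, List.mem_append, List.mem_singleton]
        congr 2
        refine propext ⟨?_, ?_⟩
        · rintro ⟨i, hi, rfl⟩; exact ⟨i, Or.inl hi, rfl⟩
        · rintro ⟨i, hi | rfl, rfl⟩
          · exact ⟨i, hi, rfl⟩
          · exact absurd rfl hjk
    have h2 := FlipChain.cons hflip (hupd ▸ h1)
    rw [hrk] at h2
    simpa using h2

/-! ### The local moves -/

/-- The change of the occupation numbers when a path is raised at the `k`-th diagonal: the entry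
at `(τ', τ)` is the probability to go from `τ` to `τ'`. -/
def moveMat (w : VertexWeights I) (hN : 0 < N) (k : Fin (N + 1)) :
    Matrix (Fin N → Fin (I + 1)) (Fin N → Fin (I + 1)) ℝ :=
  if (k : ℕ) = 0 then localOne (Matrix.of fun o i => w.Kl i o) ⟨0, hN⟩
  else if hkN : (k : ℕ) = N then localOne (Matrix.of fun o i => w.Kr i o) ⟨N - 1, by omega⟩
  -- Before the move site `k - 1` carries the horizontal and site `k` the vertical incoming edge;
  -- afterwards site `k - 1` carries the vertical and site `k` the horizontal outgoing edge.
  else localTwo (Matrix.of fun o p => w.R p.2 p.1 o.1 o.2) ⟨k - 1, by omega⟩ ⟨k, by omega⟩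

theorem moveMat_stochastic {w : VertexWeights I} (hw : w.IsStochastic) (hN : 0 < N)
    (k : Fin (N + 1)) : IsColStochastic (moveMat w hN k) := by
  unfold moveMat
  split_ifs with h0 hkN
  · exact IsColStochastic.localOne ⟨fun o i => hw.Kl_nonneg i o, fun i => hw.Kl_sum i⟩ _
  · exact IsColStochastic.localOne ⟨fun o i => hw.Kr_nonneg i o, fun i => hw.Kr_sum i⟩ _
  · refine IsColStochastic.localTwo ⟨fun o i => hw.R_nonneg _ _ _ _, fun i => ?_⟩ ?_
    · rw [Fintype.sum_prod_type]; exact hw.R_sum _ _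
    · rw [Ne, Fin.mk.injEq]; omega

section EdgesOfFlip

variable {h : ℕ → ℕ} {k : ℕ}

theorem edgeOf_update_of_ne {i : Fin N} (h1 : (i : ℕ) ≠ k) (h2 : (i : ℕ) + 1 ≠ k) (a : ℕ) :
    edgeOf (Function.update h k a) i = edgeOf h i := by
  simp [edgeOf, h1, h2]

theorem dirOf_update_of_ne {i : Fin N} (h1 : (i : ℕ) ≠ k) (h2 : (i : ℕ) + 1 ≠ k) (a : ℕ) :
    dirOf (Function.update h k a) i = dirOf h i := by
  simp [dirOf, h1, h2]

theorem Flippable.edgeOf_self (hf : Flippable N h k) (hk : k < N) :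
    edgeOf h (⟨k, hk⟩ : Fin N) = ((h k + 1 + k, h k + 1), Dir.up) := by
  simp only [edgeOf, hf.2 hk, if_true]
  congr 2; omega

theorem Flippable.edgeOf_update_self (hf : Flippable N h k) (hk : k < N) :
    edgeOf (Function.update h k (h k + 1)) (⟨k, hk⟩ : Fin N) =
      ((h k + 1 + k + 1, h k + 1), Dir.right) := by
  simp [edgeOf, hf.2 hk]

theorem Flippable.edgeOf_pred (hf : Flippable N h k) (hk0 : k ≠ 0) (hk : k - 1 < N) :
    edgeOf h (⟨k - 1, hk⟩ : Fin N) = ((h k + 1 + k, h k + 1), Dir.right) := by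
  have e : k - 1 + 1 = k := by omega
  simp only [edgeOf, hf.1 hk0, e]
  rw [if_neg (by omega)]
  congr 2; omega

theorem Flippable.edgeOf_update_pred (hf : Flippable N h k) (hk0 : k ≠ 0) (hk : k - 1 < N) :
    edgeOf (Function.update h k (h k + 1)) (⟨k - 1, hk⟩ : Fin N) =
      ((h k + 1 + k, h k + 1 + 1), Dir.up) := by
  have e : k - 1 + 1 = k := by omega
  have e' : k - 1 ≠ k := by omega
  simp only [edgeOf, e, Function.update_self, Function.update_of_ne e', hf.1 hk0, if_true]
  congr 2; omega

theorem Flippable.dirOf_self (hf : Flippable N h k) (hk : k < N) :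
    dirOf h (⟨k, hk⟩ : Fin N) = Dir.up := by
  simp only [dirOf, hf.2 hk, if_true]

theorem Flippable.dirOf_update_self (hf : Flippable N h k) (hk : k < N) :
    dirOf (Function.update h k (h k + 1)) (⟨k, hk⟩ : Fin N) = Dir.right := by
  simp [dirOf, hf.2 hk]

theorem Flippable.dirOf_pred (hf : Flippable N h k) (hk0 : k ≠ 0) (hk : k - 1 < N) :
    dirOf h (⟨k - 1, hk⟩ : Fin N) = Dir.right := by
  have e : k - 1 + 1 = k := by omega
  simp only [dirOf, hf.1 hk0, e]
  rw [if_neg (by omega)]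

theorem Flippable.dirOf_update_pred (hf : Flippable N h k) (hk0 : k ≠ 0) (hk : k - 1 < N) :
    dirOf (Function.update h k (h k + 1)) (⟨k - 1, hk⟩ : Fin N) = Dir.up := by
  have e : k - 1 + 1 = k := by omega
  have e' : k - 1 ≠ k := by omega
  simp only [dirOf, e, Function.update_self, Function.update_of_ne e', hf.1 hk0, if_true]

end EdgesOfFlip

/-- The first step of the sampling is a local move. -/
theorem sampleExp_cons (w : VertexWeights I) (hN : 0 < N) {h : ℕ → ℕ} {k : Fin (N + 1)}
    (hf : Flippable N h k) (vs : List (ℕ × ℕ)) (f : (Edge → Fin (I + 1)) → ℝ)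
    (F : (Fin N → Fin (I + 1)) → ℝ)
    (hF : ∀ η, sampleExp w N vs f η =
      F fun i => η (edgeOf (Function.update h k (h k + 1)) i)) (η : Edge → Fin (I + 1)) :
    sampleExp w N ((h k + 1 + k, h k + 1) :: vs) f η =
      ∑ o, moveMat w hN k o (fun i => η (edgeOf h i)) * F o := by
  have hinj := edgeOf_injective (N := N) (Function.update h k (h k + 1))
  rw [sampleExp]
  simp only [hF]
  unfold moveMat
  have hk := k.2
  by_cases h0 : (k : ℕ) = 0
  · have hkN : (k : ℕ) < N := by omega
    rw [if_pos (by omega), if_pos h0, sum_localOne]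
    have e : (⟨0, hN⟩ : Fin N) = ⟨k, hkN⟩ := Fin.ext h0.symm
    simp only [e, Matrix.of_apply, hf.edgeOf_self hkN, ← hf.edgeOf_update_self hkN]
    refine Finset.sum_congr rfl fun d _ => ?_
    congr 2
    funext i
    by_cases hi : i = ⟨k, hkN⟩
    · subst hi; simp
    · rw [Function.update_of_ne (hinj.ne hi), Function.update_of_ne hi, edgeOf_update_of_ne]
      · exact fun h => hi (Fin.ext h)
      · omega
  · rw [if_neg (by omega), if_neg h0]
    by_cases hkN : (k : ℕ) = N
    · have hk' : (k : ℕ) - 1 < N := by omega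
      rw [if_pos (by omega), dif_pos hkN, sum_localOne]
      have e : (⟨N - 1, by omega⟩ : Fin N) = ⟨k - 1, hk'⟩ := Fin.ext (by simp only; omega)
      simp only [e, Matrix.of_apply, hf.edgeOf_pred h0 hk', ← hf.edgeOf_update_pred h0 hk']
      refine Finset.sum_congr rfl fun d _ => ?_
      congr 2
      funext i
      by_cases hi : i = ⟨k - 1, hk'⟩
      · subst hi; simp
      · rw [Function.update_of_ne (hinj.ne hi), Function.update_of_ne hi, edgeOf_update_of_ne]
        · omega
        · exact fun h => hi (Fin.ext (by simp only; omega))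
    · have hk' : (k : ℕ) - 1 < N := by omega
      have hk'' : (k : ℕ) < N := by omega
      have hst : (⟨k - 1, hk'⟩ : Fin N) ≠ ⟨k, hk''⟩ := by rw [Ne, Fin.mk.injEq]; omega
      rw [if_neg (by omega), dif_neg hkN, sum_localTwo _ hst, Fintype.sum_prod_type]
      simp only [Matrix.of_apply, hf.edgeOf_self hk'', ← hf.edgeOf_update_self hk'',
        hf.edgeOf_pred h0 hk', ← hf.edgeOf_update_pred h0 hk']
      refine Finset.sum_congr rfl fun c _ => Finset.sum_congr rfl fun d _ => ?_
      congr 2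
      funext i
      by_cases hi : i = ⟨k, hk''⟩
      · subst hi; simp
      · rw [Function.update_of_ne (hinj.ne hi), Function.update_of_ne hi]
        by_cases hi' : i = ⟨k - 1, hk'⟩
        · subst hi'; simp
        · rw [Function.update_of_ne (hinj.ne hi'), Function.update_of_ne hi', edgeOf_update_of_ne]
          · exact fun h => hi (Fin.ext h)
          · exact fun h => hi' (Fin.ext (by simp only; omega))

/-- The vertex sampled first gives the operator that acts first, hence the rightmost factor; this
accounts for the reversed list. -/
theorem sampleExp_flipChain (w : VertexWeights I) (hN : 0 < N) {h h' : ℕ → ℕ}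
    {ks : List (Fin (N + 1))} {vs : List (ℕ × ℕ)} (hc : FlipChain N h ks vs h')
    (g : (Fin N → Fin (I + 1)) → ℝ) (η : Edge → Fin (I + 1)) :
    sampleExp w N vs (fun η => g fun i => η (edgeOf h' i)) η =
      ∑ o, (ks.reverse.map (moveMat w hN)).prod o (fun i => η (edgeOf h i)) * g o := by
  induction hc generalizing η with
  | nil h => simp [sampleExp, Matrix.one_apply]
  | @cons h h' k ks vs hf _ ih =>
    rw [sampleExp_cons w hN hf vs _ (fun τ => ∑ o, (ks.reverse.map (moveMat w hN)).prod o τ * g o)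
      ih]
    simp only [List.reverse_cons, List.map_append, List.map_cons, List.map_nil, List.prod_append,
      List.prod_singleton, Matrix.mul_apply, Finset.mul_sum, Finset.sum_mul]
    rw [Finset.sum_comm]
    refine Finset.sum_congr rfl fun o _ => Finset.sum_congr rfl fun o' _ => ?_
    ring

/-! ### Heights of a down-right path -/

/-- The height of the vertex of a path on the `k`-th diagonal. -/
def DownRightPath.height (P : DownRightPath N) (k : ℕ) : ℕ :=
  if hk : k < N + 1 then (P.vert ⟨k, hk⟩).2 else 0

theorem DownRightPath.height_val (P : DownRightPath N) (k : Fin (N + 1)) :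
    P.height k = (P.vert k).2 := by
  rw [height, dif_pos k.2]

theorem DownRightPath.vert_fst (P : DownRightPath N) (k : Fin (N + 1)) :
    (P.vert k).1 = (P.vert k).2 + k := by
  induction k using Fin.induction with
  | zero => simpa using P.left_boundary
  | succ i ih =>
    have := P.step i
    simp only [Fin.val_castSucc, Fin.val_succ] at ih ⊢
    omega

theorem DownRightPath.height_step (P : DownRightPath N) (k : ℕ) (hk : k < N) :
    P.height (k + 1) = P.height k ∨ P.height (k + 1) + 1 = P.height k := by
  have h1 := P.height_val (⟨k, hk⟩ : Fin N).castSucc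
  have h2 := P.height_val (⟨k, hk⟩ : Fin N).succ
  simp only [Fin.val_castSucc, Fin.val_succ] at h1 h2
  rw [h1, h2]
  have := P.step ⟨k, hk⟩
  omega

theorem DownRightPath.height_le (P : DownRightPath N) (k : ℕ) (hk : k ≤ N) :
    P.height k ≤ P.height 0 := by
  induction k with
  | zero => rfl
  | succ k ih =>
    have := P.height_step k (by omega)
    have := ih (by omega)
    omega

theorem DownRightPath.dirOf_height (P : DownRightPath N) : dirOf P.height = P.dir := by
  funext i
  have h1 := P.height_val i.castSucc
  have h2 := P.height_val i.succ
  simp only [Fin.val_castSucc, Fin.val_succ] at h1 h2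
  rw [dirOf, DownRightPath.dir, h1, h2]

theorem DownRightPath.outEdge_eq (P : DownRightPath N) (i : Fin N) :
    P.outEdge i = edgeOf P.height i := by
  have h1 := P.height_val i.castSucc
  have h2 := P.height_val i.succ
  have h3 := P.vert_fst i.castSucc
  have h4 := P.vert_fst i.succ
  simp only [Fin.val_castSucc, Fin.val_succ] at h1 h2 h3 h4
  rw [DownRightPath.outEdge, DownRightPath.dir, edgeOf, h1, h2]
  split_ifs with h
  · simp only [h4, h]
    congr 2
  · simp only [h3]

/-- The diagonals at which a path is raised successively to obtain its translate. -/
def DownRightPath.raiseList (P : DownRightPath N) : List (Fin (N + 1)) :=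
  -- The heights are at most `P.height 0`, so the new vertices have `y ≤ P.height 0 + 1`.
  (List.range (P.height 0 + 2)).flatMap fun y =>
    (List.finRange (N + 1)).filter fun k : Fin (N + 1) => decide (P.height k + 1 = y)

theorem DownRightPath.mem_raiseList (P : DownRightPath N) (k : Fin (N + 1)) :
    k ∈ P.raiseList := by
  have := P.height_le k (by omega)
  simp only [raiseList, List.mem_flatMap, List.mem_range, List.mem_filter, List.mem_finRange,
    true_and, decide_eq_true_eq]
  exact ⟨_, by omega, rfl⟩

theorem DownRightPath.pairwise_raiseList (P : DownRightPath N) :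
    P.raiseList.Pairwise fun j k : Fin (N + 1) =>
      P.height j < P.height k ∨ (P.height j = P.height k ∧ j < k) := by
  rw [raiseList, List.pairwise_flatMap]
  refine ⟨fun y _ => ?_, ?_⟩
  · rw [List.pairwise_filter]
    refine (List.pairwise_lt_finRange (N + 1)).imp fun {j k} hjk h1 h2 => Or.inr ⟨?_, hjk⟩
    simp only [decide_eq_true_eq] at h1 h2
    omega
  · refine List.pairwise_lt_range.imp fun {y y'} hy j hj k hk => Or.inl ?_
    simp only [List.mem_filter, decide_eq_true_eq] at hj hk
    omega

theorem DownRightPath.between_shift (P : DownRightPath N) :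
    P.between P.shift = P.raiseList.map fun k : Fin (N + 1) => (P.height k + 1 + k, P.height k + 1) := by
  rw [DownRightPath.between, DownRightPath.raiseList, List.map_flatMap]
  have h0 : P.height 0 = (P.vert 0).2 := P.height_val 0
  have e : (P.shift.vert 0).2 + 1 = P.height 0 + 2 := by rw [h0]; rfl
  rw [e]
  congr 1
  funext y
  have e2 : (fun k : Fin (N + 1) => decide ((P.vert k).2 < y ∧ y ≤ (P.shift.vert k).2)) =
      fun k : Fin (N + 1) => decide (P.height k + 1 = y) := by
    funext k
    rw [P.height_val]
    simp only [DownRightPath.shift]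
    congr 1
    refine propext ⟨fun h => by omega, fun h => by omega⟩
  rw [e2]
  simp only [List.bind_eq_flatMap, List.pure_def, ← List.map_eq_flatMap, List.map_map]
  refine List.map_congr_left fun k hk => ?_
  simp only [List.mem_filter, decide_eq_true_eq] at hk
  rw [hk.2]
  rfl

theorem DownRightPath.edgeOf_raise (P : DownRightPath N) (i : Fin N) :
    edgeOf (raise P.height P.raiseList) i = P.shift.outEdge i := by
  have h1 : ∀ k : Fin (N + 1), raise P.height P.raiseList k = P.shift.height k := by
    intro k
    rw [raise, if_pos ⟨k, P.mem_raiseList k, rfl⟩, P.height_val, P.shift.height_val]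
    rfl
  have h2 := h1 i.castSucc
  have h3 := h1 i.succ
  simp only [Fin.val_castSucc, Fin.val_succ] at h2 h3
  rw [P.shift.outEdge_eq, edgeOf, edgeOf, h2, h3]

theorem DownRightPath.dirOf_raise (P : DownRightPath N) :
    dirOf (raise P.height P.raiseList) = P.dir := by
  funext i
  have h1 : ∀ k : Fin (N + 1), raise P.height P.raiseList k = P.height k + 1 := fun k => by
    rw [raise, if_pos ⟨k, P.mem_raiseList k, rfl⟩]
  have h2 := h1 i.castSucc
  have h3 := h1 i.succ
  simp only [Fin.val_castSucc, Fin.val_succ] at h2 h3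
  rw [← P.dirOf_height, dirOf, dirOf, h2, h3]
  simp only [Nat.add_right_cancel_iff]

theorem DownRightPath.flipChain (P : DownRightPath N) :
    FlipChain N P.height P.raiseList (P.between P.shift) (raise P.height P.raiseList) := by
  have h := flipChain_raise P.height_step P.raiseList [] P.pairwise_raiseList P.mem_raiseList
  have e : raise P.height ([] : List (Fin (N + 1))) = P.height := by funext k; simp [raise]
  rw [e, List.nil_append] at h
  rw [P.between_shift]
  exact h

/-- `transition` has initial states as rows and the moves have them as columns, so the arguments are
interchanged. The edges of `P` are distinct, so the extension of `τ` restricts to `τ` on them. -/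
theorem transition_eq (w : VertexWeights I) (hN : 0 < N) (P : DownRightPath N)
    (τ τ' : Fin N → Fin (I + 1)) :
    transition w P P.shift τ τ' = (P.raiseList.reverse.map (moveMat w hN)).prod τ' τ := by
  classical
  have h := sampleExp_flipChain w hN P.flipChain (fun o => if ∀ i, o i = τ' i then 1 else 0)
    (Function.extend P.outEdge τ fun _ => 0)
  have hinj : Function.Injective P.outEdge := by
    rw [show P.outEdge = edgeOf P.height from funext P.outEdge_eq]
    exact edgeOf_injective _
  simp only [P.edgeOf_raise, ← P.outEdge_eq, hinj.extend_apply, ← funext_iff, mul_ite, mul_one,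
    mul_zero, Finset.sum_ite_eq', Finset.mem_univ, if_true] at h
  rw [← h, transition, Matrix.of_apply]
  simp only [funext_iff]

end Strip

section StationaryState

variable {N I : ℕ} {A : Type*} [Ring A] [Algebra ℝ A] {E : Type*} [AddCommGroup E] [Module ℝ E]

/-! ### Transport of the matrix product state -/

/-- The matrix product state on a path with directions `p`, before normalization. -/
def mpsVector (φ : A →ₗ[ℝ] E) (M : Dir → Fin (I + 1) → A) (p : Fin N → Dir) :
    (Fin N → Fin (I + 1)) → E :=
  fun τ => φ (word M ((List.finRange N).map fun i => (i, p i)) τ)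

theorem map_congr_dir {ks : List (Fin N)} {p p' : Fin N → Dir} (h : ∀ i ∈ ks, p i = p' i) :
    (ks.map fun i => (i, p i)) = ks.map fun i => (i, p' i) :=
  List.map_congr_left fun i hi => by rw [h i hi]

/-- The relations of a matrix product ansatz for vertex weights on a strip. -/
structure IsAnsatz (w : VertexWeights I) (φ : A →ₗ[ℝ] E) (M : Dir → Fin (I + 1) → A) : Prop where
  bulk : ∀ o : Fin (I + 1) × Fin (I + 1), ∑ p : Fin (I + 1) × Fin (I + 1),
    w.R p.2 p.1 o.1 o.2 • (M Dir.right p.1 * M Dir.up p.2) = M Dir.up o.1 * M Dir.right o.2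
  left : ∀ o a, φ ((∑ p, w.Kl p o • M Dir.up p) * a) = φ (M Dir.right o * a)
  right : ∀ o a, φ (a * ∑ p, w.Kr p o • M Dir.right p) = φ (a * M Dir.up o)

/-- A flippable diagonal meets the pattern `→ ↑` in the bulk, an initial `↑` at the left, or a final
`→` at the right, and no other direction changes. The word is split around these sites and the
relation in question is applied. -/
theorem act_moveMat_mpsVector {w : VertexWeights I} {φ : A →ₗ[ℝ] E} {M : Dir → Fin (I + 1) → A}
    (hM : IsAnsatz w φ M) (hN : 0 < N) {h : ℕ → ℕ} {k : Fin (N + 1)} (hf : Flippable N h k) :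
    act (moveMat w hN k) (mpsVector φ M (dirOf h)) =
      mpsVector φ M (dirOf (Function.update h k (h k + 1))) := by
  have hnd := List.nodup_finRange N
  have hk := k.2
  unfold moveMat mpsVector
  by_cases h0 : (k : ℕ) = 0
  · have hkN : (k : ℕ) < N := by omega
    rw [if_pos h0]
    have e : (⟨0, hN⟩ : Fin N) = ⟨k, hkN⟩ := Fin.ext h0.symm
    obtain ⟨L, hL⟩ : ∃ L, List.finRange N = ⟨k, hkN⟩ :: L := by
      refine ⟨(List.finRange N).drop 1, ?_⟩
      rw [← e]
      conv_lhs => rw [← List.drop_zero (l := List.finRange N),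
        List.drop_eq_getElem_cons (by simpa using hN)]
      simp
    rw [hL, List.nodup_cons] at hnd
    have hd : ∀ i ∈ L, dirOf (Function.update h k (h k + 1)) i = dirOf h i := fun i hi => by
      refine dirOf_update_of_ne (fun h => hnd.1 ?_) (by omega) _
      rwa [← show i = ⟨k, hkN⟩ from Fin.ext h]
    rw [hL, e, List.map_cons, List.map_cons, hf.dirOf_self hkN, hf.dirOf_update_self hkN,
      map_congr_dir hd]
    exact act_localOne_head φ M _ _ Dir.up Dir.right hM.left
      (by simpa [List.map_map, Function.comp_def] using hnd.1)
  · rw [if_neg h0]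
    by_cases hkN : (k : ℕ) = N
    · have hk' : (k : ℕ) - 1 < N := by omega
      rw [dif_pos hkN]
      have e : (⟨N - 1, by omega⟩ : Fin N) = ⟨k - 1, hk'⟩ := Fin.ext (by simp only; omega)
      obtain ⟨L, hL⟩ : ∃ L, List.finRange N = L ++ [⟨k - 1, hk'⟩] := by
        refine ⟨(List.finRange N).take (k - 1), ?_⟩
        conv_lhs => rw [← List.take_append_drop (k - 1) (List.finRange N),
          List.drop_eq_getElem_cons (by simpa using hk'), List.drop_eq_nil_of_le (by simp; omega)]
        simp
      rw [hL, List.nodup_append] at hnd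
      have hnot : (⟨k - 1, hk'⟩ : Fin N) ∉ L := fun hm => hnd.2.2 _ hm _ (by simp) rfl
      have hd : ∀ i ∈ L, dirOf (Function.update h k (h k + 1)) i = dirOf h i := fun i hi => by
        refine dirOf_update_of_ne (by omega) (fun h => hnot ?_) _
        rwa [← show i = ⟨k - 1, hk'⟩ from Fin.ext (by simp only; omega)]
      rw [hL, e, List.map_append, List.map_append, List.map_singleton, List.map_singleton,
        hf.dirOf_pred h0 hk', hf.dirOf_update_pred h0 hk', map_congr_dir hd]
      exact act_localOne_last φ M _ _ Dir.right Dir.up hM.right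
        (by simpa [List.map_map, Function.comp_def] using hnot)
    · have hk' : (k : ℕ) - 1 < N := by omega
      have hk'' : (k : ℕ) < N := by omega
      have hst : (⟨k - 1, hk'⟩ : Fin N) ≠ ⟨k, hk''⟩ := by rw [Ne, Fin.mk.injEq]; omega
      rw [dif_neg hkN]
      obtain ⟨L, L', hL⟩ : ∃ L L', List.finRange N = L ++ ⟨k - 1, hk'⟩ :: ⟨k, hk''⟩ :: L' := by
        refine ⟨(List.finRange N).take (k - 1), (List.finRange N).drop (k + 1), ?_⟩
        have e : (k : ℕ) - 1 + 1 = k := by omega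
        conv_lhs => rw [← List.take_append_drop (k - 1) (List.finRange N),
          List.drop_eq_getElem_cons (by simpa using hk'), e,
          List.drop_eq_getElem_cons (by simpa using hk'')]
        simp
      rw [hL, List.nodup_append, List.nodup_cons, List.nodup_cons] at hnd
      obtain ⟨-, ⟨h1, h2, -⟩, h3⟩ := hnd
      have h1' : (⟨k - 1, hk'⟩ : Fin N) ∉ L' := fun hm => h1 (by simp [hm])
      have h4 : (⟨k - 1, hk'⟩ : Fin N) ∉ L := fun hm => h3 _ hm _ (by simp) rfl
      have h5 : (⟨k, hk''⟩ : Fin N) ∉ L := fun hm => h3 _ hm _ (by simp) rfl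
      have hd : ∀ l : List (Fin N), ⟨k - 1, hk'⟩ ∉ l → ⟨k, hk''⟩ ∉ l →
          ∀ i ∈ l, dirOf (Function.update h k (h k + 1)) i = dirOf h i := by
        intro l hl hl' i hi
        refine dirOf_update_of_ne (fun h => hl' ?_) (fun h => hl ?_) _
        · rwa [← show i = ⟨k, hk''⟩ from Fin.ext h]
        · rwa [← show i = ⟨k - 1, hk'⟩ from Fin.ext (by simp only; omega)]
      rw [hL, List.map_append, List.map_append, List.map_cons, List.map_cons, List.map_cons,
        List.map_cons, hf.dirOf_pred h0 hk', hf.dirOf_update_pred h0 hk', hf.dirOf_self hk'',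
        hf.dirOf_update_self hk'', map_congr_dir (hd L h4 h5), map_congr_dir (hd L' h1' h2),
        act_comp]
      funext z
      rw [act_localTwo_word M (Matrix.of fun o p => w.R p.2 p.1 o.1 o.2) hst Dir.right Dir.up _
        hM.bulk (L := L.map fun i => (i, dirOf h i)) (L' := L'.map fun i => (i, dirOf h i))
        (by simpa [List.map_map, Function.comp_def] using h4)
        (by simpa [List.map_map, Function.comp_def] using h1')
        (by simpa [List.map_map, Function.comp_def] using h5)
        (by simpa [List.map_map, Function.comp_def] using h2)]
      simp only [word_append, word_cons, mul_assoc]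

theorem act_flipChain_mpsVector {w : VertexWeights I} {φ : A →ₗ[ℝ] E} {M : Dir → Fin (I + 1) → A}
    (hM : IsAnsatz w φ M) (hN : 0 < N) {h h' : ℕ → ℕ} {ks : List (Fin (N + 1))}
    {vs : List (ℕ × ℕ)} (hc : FlipChain N h ks vs h') :
    act (ks.reverse.map (moveMat w hN)).prod (mpsVector φ M (dirOf h)) =
      mpsVector φ M (dirOf h') := by
  induction hc with
  | nil h => exact act_one _
  | cons hf _ ih =>
    rw [List.reverse_cons, List.map_append, List.prod_append, act_mul, List.map_singleton,
      List.prod_singleton, act_moveMat_mpsVector hM hN hf, ih]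

/-- The matrix product state is invariant. -/
theorem transition_mpsVector {w : VertexWeights I} {φ : A →ₗ[ℝ] E} {M : Dir → Fin (I + 1) → A}
    (hM : IsAnsatz w φ M) (hN : 0 < N) (P : DownRightPath N) (τ' : Fin N → Fin (I + 1)) :
    ∑ τ, transition w P P.shift τ τ' • mpsVector φ M P.dir τ = mpsVector φ M P.dir τ' := by
  have h := congrFun (act_flipChain_mpsVector hM hN P.flipChain) τ'
  rw [P.dirOf_raise, P.dirOf_height] at h
  simp only [transition_eq w hN]
  exact h

theorem transition_nonneg {w : VertexWeights I} (hw : w.IsStochastic) (hN : 0 < N)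
    (P : DownRightPath N) (τ τ' : Fin N → Fin (I + 1)) : 0 ≤ transition w P P.shift τ τ' := by
  rw [transition_eq w hN]
  exact (IsColStochastic.list_prod _ _ fun k _ => moveMat_stochastic hw hN k).nonneg _ _

theorem sum_transition {w : VertexWeights I} (hw : w.IsStochastic) (hN : 0 < N)
    (P : DownRightPath N) (τ : Fin N → Fin (I + 1)) :
    ∑ τ', transition w P P.shift τ τ' = 1 := by
  simp only [transition_eq w hN]
  exact (IsColStochastic.list_prod _ _ fun k _ => moveMat_stochastic hw hN k).sum_col _

theorem sum_mpsVector (φ : A →ₗ[ℝ] E) (M : Dir → Fin (I + 1) → A) (p : Fin N → Dir) :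
    ∑ τ, mpsVector φ M p τ = φ (prodInc fun i => ∑ j, M (p i) j) := by
  have h : ∀ (N : ℕ) (p : Fin N → Dir), ∑ τ : Fin N → Fin (I + 1),
      word M ((List.finRange N).map fun i => (i, p i)) τ = prodInc fun i => ∑ j, M (p i) j := by
    intro N
    induction N with
    | zero => intro p; simp [word, prodInc]
    | succ N ih =>
      intro p
      have h1 := ih fun i => p i.succ
      rw [← (Fin.consEquiv fun _ => Fin (I + 1)).sum_comp, Fintype.sum_prod_type]
      simp only [prodInc, word, List.finRange_succ, List.map_cons, List.prod_cons, List.map_map,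
        Function.comp_def, Fin.consEquiv_apply, Fin.cons_zero, Fin.cons_succ] at h1 ⊢
      rw [← h1, Finset.sum_mul_sum]
  rw [← h, map_sum]
  rfl

/-! ### The empty configuration is reached from everywhere -/

/-- The number of steps after which an arrow that moves straight on leaves the strip. -/
def exitTime (h : ℕ → ℕ) (i : Fin N) : ℕ := if h (i + 1) = h i then i + 1 else N - i

/-- The total number of steps after which arrows that move straight on have left the strip. -/
def exitSum (h : ℕ → ℕ) (τ : Fin N → Fin (I + 1)) : ℕ := ∑ i, (τ i : ℕ) * exitTime h i

/-- Arrows move straight on, and are absorbed at the boundaries, with positive probability. -/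
structure VertexWeights.MovesOn (w : VertexWeights I) : Prop where
  R_pos : ∀ i j, 0 < w.R i j i j
  Kl_pos : ∀ i, 0 < w.Kl i 0
  Kr_pos : ∀ j, 0 < w.Kr j 0

theorem exitTime_update_of_ne {h : ℕ → ℕ} {k : ℕ} {i : Fin N} (h1 : (i : ℕ) ≠ k)
    (h2 : (i : ℕ) + 1 ≠ k) (a : ℕ) : exitTime (Function.update h k a) i = exitTime h i := by
  simp [exitTime, h1, h2]

section ExitTimeOfFlip

variable {h : ℕ → ℕ} {k : ℕ}

theorem Flippable.exitTime_self (hf : Flippable N h k) (hk : k < N) :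
    exitTime h (⟨k, hk⟩ : Fin N) = k + 1 := by
  simp only [exitTime, hf.2 hk, if_true]

theorem Flippable.exitTime_update_self (hf : Flippable N h k) (hk : k < N) :
    exitTime (Function.update h k (h k + 1)) (⟨k, hk⟩ : Fin N) = N - k := by
  simp [exitTime, hf.2 hk]

theorem Flippable.exitTime_pred (hf : Flippable N h k) (hk0 : k ≠ 0) (hk : k - 1 < N) :
    exitTime h (⟨k - 1, hk⟩ : Fin N) = N - (k - 1) := by
  have e : k - 1 + 1 = k := by omega
  simp only [exitTime, hf.1 hk0, e]
  rw [if_neg (by omega)]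

theorem Flippable.exitTime_update_pred (hf : Flippable N h k) (hk0 : k ≠ 0) (hk : k - 1 < N) :
    exitTime (Function.update h k (h k + 1)) (⟨k - 1, hk⟩ : Fin N) = k := by
  have e : k - 1 + 1 = k := by omega
  have e' : k - 1 ≠ k := by omega
  simp only [exitTime, e, Function.update_self, Function.update_of_ne e', hf.1 hk0, if_true]

end ExitTimeOfFlip

/-- Comparison of the exit sums before and after a rearrangement of the arrows. -/
theorem exitSum_le_of_perm (h h' : ℕ → ℕ) (τ τ' : Fin N → Fin (I + 1)) (σ : Equiv.Perm (Fin N))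
    (hle : ∀ i, (τ' i : ℕ) * exitTime h' i ≤ (τ (σ i) : ℕ) * exitTime h (σ i)) :
    exitSum h' τ' ≤ exitSum h τ ∧ (exitSum h' τ' = exitSum h τ →
      ∀ i, (τ' i : ℕ) * exitTime h' i = (τ (σ i) : ℕ) * exitTime h (σ i)) := by
  have e : exitSum h τ = ∑ i, (τ (σ i) : ℕ) * exitTime h (σ i) :=
    (Equiv.sum_comp σ fun i => (τ i : ℕ) * exitTime h i).symm
  rw [e, exitSum]
  exact ⟨Finset.sum_le_sum fun i _ => hle i, fun heq i =>
    (Finset.sum_eq_sum_iff_of_le fun i _ => hle i).1 heq i (Finset.mem_univ _)⟩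

/-- Each arrow that passes the vertex straight on gets one step closer to its exit, and at a
boundary it disappears. Hence the exit sum can stay constant only if no arrow enters the vertex, and
then nothing has changed. In the bulk, going straight on exchanges the occupation numbers of the two
sites. -/
theorem exists_moveMat_pos {w : VertexWeights I} (hw : w.MovesOn) (hN : 0 < N) {h : ℕ → ℕ}
    {k : Fin (N + 1)} (hf : Flippable N h k) (τ : Fin N → Fin (I + 1)) :
    ∃ τ', 0 < moveMat w hN k τ' τ ∧
      exitSum (Function.update h k (h k + 1)) τ' ≤ exitSum h τ ∧
      (exitSum (Function.update h k (h k + 1)) τ' = exitSum h τ →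
        τ' = τ ∧ ∀ i : Fin N, i.castSucc = k → τ i = 0) := by
  have hk := k.2
  unfold moveMat
  by_cases h0 : (k : ℕ) = 0
  · have hkN : (k : ℕ) < N := by omega
    have e : (⟨0, hN⟩ : Fin N) = ⟨k, hkN⟩ := Fin.ext h0.symm
    rw [if_pos h0, e]
    obtain ⟨h1, h2⟩ := exitSum_le_of_perm h (Function.update h k (h k + 1)) τ
      (Function.update τ ⟨k, hkN⟩ 0) 1 (fun i => by
        by_cases hi : i = ⟨k, hkN⟩
        · subst hi; simp
        · rw [Function.update_of_ne hi, exitTime_update_of_ne (k := k) (fun h => hi (Fin.ext h))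
            (by omega)]
          rfl)
    refine ⟨Function.update τ ⟨k, hkN⟩ 0, ?_, h1, fun heq => ?_⟩
    · simp only [localOne, Matrix.of_apply]
      rw [if_pos fun i hi => Function.update_of_ne hi _ _, Function.update_self]
      exact hw.Kl_pos _
    · have h3 := h2 heq ⟨k, hkN⟩
      rw [Function.update_self, Equiv.Perm.one_apply, hf.exitTime_self hkN] at h3
      have h4 : τ ⟨k, hkN⟩ = 0 := by
        simp only [Fin.val_zero, zero_mul, zero_eq_mul, Nat.add_eq_zero_iff, one_ne_zero, and_false,
          or_false] at h3
        exact Fin.ext h3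
      refine ⟨?_, fun i hi => ?_⟩
      · conv_rhs => rw [← Function.update_eq_self ⟨k, hkN⟩ τ, h4]
      · rw [← h4]; congr 1; exact Fin.ext (by simpa using congrArg Fin.val hi)
  · rw [if_neg h0]
    by_cases hkN : (k : ℕ) = N
    · have hk' : (k : ℕ) - 1 < N := by omega
      have e : (⟨N - 1, by omega⟩ : Fin N) = ⟨k - 1, hk'⟩ := Fin.ext (by simp only; omega)
      rw [dif_pos hkN, e]
      obtain ⟨h1, h2⟩ := exitSum_le_of_perm h (Function.update h k (h k + 1)) τ
        (Function.update τ ⟨k - 1, hk'⟩ 0) 1 (fun i => by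
          by_cases hi : i = ⟨k - 1, hk'⟩
          · subst hi; simp
          · rw [Function.update_of_ne hi, exitTime_update_of_ne (k := k) (by omega)
              (fun h => hi (Fin.ext (by simp only; omega)))]
            rfl)
      refine ⟨Function.update τ ⟨k - 1, hk'⟩ 0, ?_, h1, fun heq => ?_⟩
      · simp only [localOne, Matrix.of_apply]
        rw [if_pos fun i hi => Function.update_of_ne hi _ _, Function.update_self]
        exact hw.Kr_pos _
      · have h3 := h2 heq ⟨k - 1, hk'⟩
        rw [Function.update_self, Equiv.Perm.one_apply, hf.exitTime_pred h0 hk'] at h3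
        have h4 : τ ⟨k - 1, hk'⟩ = 0 := by
          rw [Fin.val_zero, zero_mul, zero_eq_mul] at h3
          exact Fin.ext (h3.resolve_right (by omega))
        refine ⟨?_, fun i hi => ?_⟩
        · conv_rhs => rw [← Function.update_eq_self ⟨k - 1, hk'⟩ τ, h4]
        · have : (i : ℕ) = k := by rw [← hi]; rfl
          omega
    · have hk' : (k : ℕ) - 1 < N := by omega
      have hk'' : (k : ℕ) < N := by omega
      have hst : (⟨k - 1, hk'⟩ : Fin N) ≠ ⟨k, hk''⟩ := by rw [Ne, Fin.mk.injEq]; omega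
      rw [dif_neg hkN]
      obtain ⟨σ, hl, hr, hne⟩ : ∃ σ : Equiv.Perm (Fin N), σ ⟨k - 1, hk'⟩ = ⟨k, hk''⟩ ∧
          σ ⟨k, hk''⟩ = ⟨k - 1, hk'⟩ ∧ ∀ i, i ≠ ⟨k - 1, hk'⟩ → i ≠ ⟨k, hk''⟩ → σ i = i :=
        ⟨Equiv.swap _ _, Equiv.swap_apply_left _ _, Equiv.swap_apply_right _ _,
          fun _ => Equiv.swap_apply_of_ne_of_ne⟩
      obtain ⟨h1, h2⟩ := exitSum_le_of_perm h (Function.update h k (h k + 1)) τ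
        (fun i => τ (σ i)) σ (fun i => by
          refine Nat.mul_le_mul_left _ ?_
          by_cases hi : i = ⟨k - 1, hk'⟩
          · rw [hi, hl, hf.exitTime_self hk'', hf.exitTime_update_pred h0 hk']
            exact Nat.le_succ _
          · by_cases hi' : i = ⟨k, hk''⟩
            · rw [hi', hr, hf.exitTime_pred h0 hk',
                hf.exitTime_update_self hk'']
              exact Nat.sub_le_sub_left (Nat.sub_le _ _) _
            · have h1 : (i : ℕ) ≠ k := fun h => hi' (Fin.ext h)
              have h2 : (i : ℕ) + 1 ≠ k := fun h => hi (Fin.ext (Nat.eq_sub_of_add_eq h))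
              have h3 := exitTime_update_of_ne (h := h) h1 h2 (h k + 1)
              rw [hne _ hi hi', h3])
      refine ⟨fun i => τ (σ i), ?_, h1, fun heq => ?_⟩
      · simp only [localTwo, Matrix.of_apply]
        rw [if_pos fun i hi hi' => by rw [hne _ hi hi'],
          hl, hr]
        exact hw.R_pos _ _
      · have h3 := h2 heq ⟨k - 1, hk'⟩
        have h4 := h2 heq ⟨k, hk''⟩
        rw [hl, hf.exitTime_self hk'',
          hf.exitTime_update_pred h0 hk'] at h3
        rw [hr, hf.exitTime_pred h0 hk',
          hf.exitTime_update_self hk'', show N - ((k : ℕ) - 1) = N - k + 1 by omega] at h4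
        have h5 : τ ⟨k, hk''⟩ = 0 := Fin.ext (by rw [Fin.val_zero]; linarith)
        have h6 : τ ⟨k - 1, hk'⟩ = 0 := Fin.ext (by rw [Fin.val_zero]; linarith)
        refine ⟨?_, fun i hi => ?_⟩
        · funext i
          by_cases hi : i = ⟨k - 1, hk'⟩
          · rw [hi, hl, h5, h6]
          · by_cases hi' : i = ⟨k, hk''⟩
            · rw [hi', hr, h5, h6]
            · rw [hne _ hi hi']
        · rw [← h5]; congr 1; exact Fin.ext (by simpa using congrArg Fin.val hi)

/-- If the exit sum is the same at both ends, it is constant along the chain; so no move changes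
`τ`, and all vertices passed were entered by no arrows. -/
theorem exists_flipChain_pos {w : VertexWeights I} (hs : w.IsStochastic) (hw : w.MovesOn)
    (hN : 0 < N) {h h' : ℕ → ℕ} {ks : List (Fin (N + 1))} {vs : List (ℕ × ℕ)}
    (hc : FlipChain N h ks vs h') (τ : Fin N → Fin (I + 1)) :
    ∃ τ', 0 < (ks.reverse.map (moveMat w hN)).prod τ' τ ∧ exitSum h' τ' ≤ exitSum h τ ∧
      (exitSum h' τ' = exitSum h τ → τ' = τ ∧ ∀ i : Fin N, i.castSucc ∈ ks → τ i = 0) := by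
  induction hc generalizing τ with
  | nil h => exact ⟨τ, by simp, le_rfl, fun _ => ⟨rfl, by simp⟩⟩
  | @cons h h' k ks vs hf _ ih =>
    obtain ⟨τ₁, h1, h2, h3⟩ := exists_moveMat_pos hw hN hf τ
    obtain ⟨τ₂, h4, h5, h6⟩ := ih τ₁
    refine ⟨τ₂, ?_, h5.trans h2, fun heq => ?_⟩
    · rw [List.reverse_cons, List.map_append, List.prod_append, List.map_singleton,
        List.prod_singleton]
      exact mul_apply_pos (IsColStochastic.list_prod _ _
        fun k _ => moveMat_stochastic hs hN k).nonneg (moveMat_stochastic hs hN k).nonneg h4 h1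
    · obtain ⟨rfl, h7⟩ := h3 (le_antisymm h2 (heq ▸ h5))
      obtain ⟨rfl, h8⟩ := h6 (le_antisymm h5 (heq ▸ h2))
      refine ⟨rfl, fun i hi => ?_⟩
      rcases List.mem_cons.1 hi with hi | hi
      exacts [h7 i hi, h8 i hi]

theorem exists_transition_pos {w : VertexWeights I} (hs : w.IsStochastic) (hw : w.MovesOn)
    (hN : 0 < N) (P : DownRightPath N) (τ : Fin N → Fin (I + 1)) (hτ : τ ≠ fun _ => 0) :
    ∃ τ', 0 < transition w P P.shift τ τ' ∧ exitSum P.height τ' < exitSum P.height τ := by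
  obtain ⟨τ', h1, h2, h3⟩ := exists_flipChain_pos hs hw hN P.flipChain τ
  have e : ∀ τ : Fin N → Fin (I + 1),
      exitSum (raise P.height P.raiseList) τ = exitSum P.height τ := by
    intro τ
    refine Finset.sum_congr rfl fun i _ => ?_
    have h1 : ∀ k : Fin (N + 1), raise P.height P.raiseList k = P.height k + 1 := fun k => by
      rw [raise, if_pos ⟨k, P.mem_raiseList k, rfl⟩]
    have h2 := h1 i.castSucc
    have h3 := h1 i.succ
    simp only [Fin.val_castSucc, Fin.val_succ] at h2 h3
    rw [exitTime, exitTime, h2, h3]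
    simp only [Nat.add_right_cancel_iff]
  rw [e] at h2 h3
  refine ⟨τ', by rwa [transition_eq w hN], lt_of_le_of_ne h2 fun heq => hτ ?_⟩
  funext i
  exact (h3 heq).2 i (P.mem_raiseList _)

end StationaryState

/-! ### The parameters of the fused weights -/

section Parameters

variable {I : ℕ} {q κ : ℝ}

theorem bdry_pos (hq0 : 0 < q) (hκ0 : 0 < κ) (i : Fin I) : 0 < bdry q κ i :=
  mul_pos hκ0 (Real.rpow_pos_of_pos hq0 _)

theorem bdry_inv_eq (hq0 : 0 < q) (i : Fin I) : bdry q κ⁻¹ i = (bdry q κ i.rev)⁻¹ := by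
  rw [bdry_rev, ← inv_inv (chain q κ i), ← inv_inv κ, ← inv_bdry hq0, inv_inv, inv_inv, inv_inv]

theorem bdry_le (hq0 : 0 < q) (hq1 : q < 1) (hκ0 : 0 < κ) (i : Fin I) :
    bdry q κ i ≤ κ / q ^ (((I : ℝ) - 1) / 2) := by
  rw [bdry, div_eq_mul_inv κ, ← Real.rpow_neg hq0.le]
  have h : (i : ℝ) + 1 ≤ I := by exact_mod_cast i.2
  refine mul_le_mul_of_nonneg_left
    (Real.rpow_le_rpow_of_exponent_ge hq0 hq1.le ?_) hκ0.le
  rw [idx]; linarith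

theorem le_bdry (hq0 : 0 < q) (hq1 : q < 1) (hκ0 : 0 < κ) (i : Fin I) :
    κ / q ^ ((1 - (I : ℝ)) / 2) ≤ bdry q κ i := by
  rw [bdry, div_eq_mul_inv κ, ← Real.rpow_neg hq0.le]
  have h : (0 : ℝ) ≤ i := by positivity
  refine mul_le_mul_of_nonneg_left
    (Real.rpow_le_rpow_of_exponent_ge hq0 hq1.le ?_) hκ0.le
  rw [idx]; linarith

theorem bdry_lt_one (hq0 : 0 < q) (hq1 : q < 1) (hκ0 : 0 < κ)
    (hκ : κ < q ^ (((I : ℝ) - 1) / 2)) (i : Fin I) : bdry q κ i < 1 :=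
  (bdry_le hq0 hq1 hκ0 i).trans_lt ((div_lt_one (Real.rpow_pos_of_pos hq0 _)).2 hκ)

theorem inv_bdry_lt (hq0 : 0 < q) (hq1 : q < 1) (hκ0 : 0 < κ) {r : ℝ}
    (hr : q ^ ((1 - (I : ℝ)) / 2) / κ < r) (i : Fin I) : (bdry q κ i)⁻¹ < r := by
  refine lt_of_le_of_lt ?_ hr
  rw [← inv_div]
  exact inv_anti₀ (div_pos hκ0 (Real.rpow_pos_of_pos hq0 _)) (le_bdry hq0 hq1 hκ0 i)

/-- Two different one-based indices add up to at most `2I - 1`; this gains the factor `q` over the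
bound `1`. It keeps `1 - q u` away from zero at the inverse parameters of `K̄`. -/
theorem bdry_mul_bdry_lt (hq0 : 0 < q) (hq1 : q < 1) (hκ0 : 0 < κ)
    (hκ : κ < q ^ (((I : ℝ) - 1) / 2)) {i j : Fin I} (hij : i ≠ j) :
    bdry q κ j * bdry q κ i < q := by
  have h1 : κ ^ 2 < q ^ ((I : ℝ) - 1) := by
    have : q ^ ((I : ℝ) - 1) = (q ^ (((I : ℝ) - 1) / 2)) ^ 2 := by
      rw [← Real.rpow_natCast, ← Real.rpow_mul hq0.le]
      congr 1; push_cast; ring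
    rw [this]
    gcongr
  have h2 : (i : ℝ) + j + 3 ≤ 2 * I := by
    have : (i : ℕ) ≠ j := fun h => hij (Fin.ext h)
    have h3 : (i : ℕ) + j + 3 ≤ 2 * I := by omega
    exact_mod_cast h3
  rw [bdry_mul_bdry hq0]
  calc κ ^ 2 * q ^ ((I : ℝ) + 1 - idx i - idx j)
      < q ^ ((I : ℝ) - 1) * q ^ ((I : ℝ) + 1 - idx i - idx j) := by
        gcongr
    _ = q ^ ((I : ℝ) - 1 + ((I : ℝ) + 1 - idx i - idx j)) := (Real.rpow_add hq0 _ _).symm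
    _ ≤ q ^ (1 : ℝ) := Real.rpow_le_rpow_of_exponent_ge hq0 hq1.le (by
        rw [idx, idx]; linarith)
    _ = q := Real.rpow_one q

theorem one_sub_mul_bdry_inv_ne_zero (hq0 : 0 < q) (hq1 : q < 1) (hκ0 : 0 < κ)
    (hκ : κ < q ^ (((I : ℝ) - 1) / 2)) {i j : Fin I} (hij : i ≠ j) :
    1 - q * (bdry q κ⁻¹ j * bdry q κ⁻¹ i) ≠ 0 := by
  have h1 := bdry_mul_bdry_lt hq0 hq1 hκ0 hκ (i := i.rev) (j := j.rev) (by simpa using hij)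
  have h2 : 0 < bdry q κ j.rev * bdry q κ i.rev :=
    mul_pos (bdry_pos hq0 hκ0 _) (bdry_pos hq0 hκ0 _)
  rw [bdry_inv_eq hq0, bdry_inv_eq hq0, ← mul_inv, ← div_eq_mul_inv]
  have := (one_lt_div h2).2 h1
  linarith

/-- This reduces the bounds on the bulk parameters to those on the boundary parameters. -/
theorem sq_mul_rpow_eq (hq0 : 0 < q) (i j : Fin I) :
    κ ^ 2 * q ^ (idx j - idx i) = bdry q κ j.rev * bdry q κ i := by
  have h := chain_div_chain hq0 κ κ⁻¹ i j
  rw [div_inv_eq_mul, ← pow_two] at h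
  rw [← h, bdry_rev, ← inv_bdry hq0, div_inv_eq_mul]

end Parameters

/-- The hypotheses on the parameters, with the consequences used for the fused weights. -/
theorem fusedWeights_isStochastic_movesOn {I : ℕ} {q κ a b c d : ℝ} (hq0 : 0 < q) (hq1 : q < 1)
    (hκ0 : 0 < κ) (hκ : κ < q ^ (((I : ℝ) - 1) / 2))
    (ha : 0 < a) (hb : 0 < b) (hc : 0 < c) (hd : 0 < d)
    (hac : q ^ ((1 - (I : ℝ)) / 2) / κ < a - c)
    (hbd : q ^ ((1 - (I : ℝ)) / 2) / κ < b - d) :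
    (fusedWeights I q κ a b c d).IsStochastic ∧ (fusedWeights I q κ a b c d).MovesOn := by
  have hpos := fun i : Fin I => bdry_pos hq0 hκ0 i
  have hlt := fun i : Fin I => bdry_lt_one hq0 hq1 hκ0 hκ i
  have hR0 : ∀ i j : Fin I, 0 < κ ^ 2 * q ^ (idx j - idx i) := fun i j => by positivity
  have hR1 : ∀ i j : Fin I, κ ^ 2 * q ^ (idx j - idx i) < 1 := fun i j => by
    rw [sq_mul_rpow_eq hq0]
    exact mul_lt_one_of_nonneg_of_lt_one_left (hpos _).le (hlt _) (hlt _).le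
  have hR := fusedR_stochastic hq0 hq1 hR0 hR1
  obtain ⟨hK, hK0⟩ := fusedK_stochastic_pos hq0 hq1 ha hc hpos hlt fun i => by
    have := inv_bdry_lt hq0 hq1 hκ0 hac i
    rwa [inv_lt_iff_one_lt_mul₀ (hpos i)] at this
  obtain ⟨hKbar, hKbar0⟩ := fusedKbar_stochastic_pos (u := κ⁻¹) (I := I) hq0 hq1 hb hd
    -- At `κ⁻¹` the parameters are the inverses of those of `K`, in reversed order.
    (fun i => by rw [bdry_inv_eq hq0]; exact (one_lt_inv₀ (hpos _)).2 (hlt _))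
    (fun i => by rw [bdry_inv_eq hq0]; exact inv_bdry_lt hq0 hq1 hκ0 hbd _)
    (fun i j hij => one_sub_mul_bdry_inv_ne_zero hq0 hq1 hκ0 hκ hij.ne)
  refine ⟨⟨fun _ _ _ _ => hR.nonneg _ _, fun _ _ => hK.nonneg _ _, fun _ _ => ?_, fun i j => ?_,
    fun _ => hK.sum_col _, fun _ => ?_, fun i j k l h => ?_⟩,
    fun i j => fusedR_diag_pos hq0 hq1 hR0 hR1 (j, i), hK0, fun j => ?_⟩
  · simp only [fusedWeights, one_div]; exact hKbar.nonneg _ _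
  · rw [← hR.sum_col (j, i), Fintype.sum_prod_type_right]; rfl
  · simp only [fusedWeights, one_div]; exact hKbar.sum_col _
  · by_contra h0
    have := fusedR_conserves _ _ _ h0
    simp only at this
    omega
  · simp only [fusedWeights, one_div]; exact hKbar0 j

/-! ### The ansatz over the complex numbers -/

section MatrixProduct

variable {A : Type*} [Ring A] [Algebra ℂ A]

theorem fusedM_ofReal (I : ℕ) (q : ℝ) (dOp eOp : A) (ζ : Fin (I + 1)) (x : ℝ) :
    fusedM I q dOp eOp ζ (x : ℂ) = fusedLetter dOp eOp I q x ζ := by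
  have h : ∀ (z : Fin 2) (y : ℝ), unfusedM dOp eOp z (y : ℂ) = letter dOp eOp y z := by
    intro z y
    rw [unfusedM, letter, IsScalarTower.algebraMap_apply ℝ ℂ A,
      IsScalarTower.algebraMap_apply ℝ ℂ A]
    simp
  simp only [fusedM, fusedLetter, act, proj, Matrix.of_apply, ite_smul, one_smul, zero_smul,
    fusedWord, word, List.map_map, prodInc, ← Complex.ofReal_mul, h]
  rfl

theorem ansatzM_eq (I : ℕ) (q κ : ℝ) (dOp eOp : A) (p : Dir) :
    ansatzM I q κ dOp eOp p =
      fusedLetter dOp eOp I q (match p with | Dir.up => κ⁻¹ | Dir.right => κ) := by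
  funext j
  cases p
  · simp only [ansatzM, ← fusedM_ofReal]
    simp
  · simp only [ansatzM, ← fusedM_ofReal]

/-- The functional `⟨W| ⋅ |V⟩`. -/
def bracket {H : Type*} [AddCommGroup H] [Module ℂ H] (ρ : A →ₐ[ℂ] Module.End ℂ H)
    (W : Module.Dual ℂ H) (V : H) : A →ₗ[ℝ] ℂ :=
  (W ∘ₗ LinearMap.applyₗ V ∘ₗ ρ.toLinearMap).restrictScalars ℝ

theorem bracket_apply {H : Type*} [AddCommGroup H] [Module ℂ H] (ρ : A →ₐ[ℂ] Module.End ℂ H)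
    (W : Module.Dual ℂ H) (V : H) (x : A) : bracket ρ W V x = W (ρ x V) := rfl

theorem mpsNumerator_eq {I N : ℕ} {H : Type*} [AddCommGroup H] [Module ℂ H]
    (ρ : A →ₐ[ℂ] Module.End ℂ H) (W : Module.Dual ℂ H) (V : H) (M : Dir → Fin (I + 1) → A)
    (p : Fin N → Dir) (τ : Fin N → Fin (I + 1)) :
    mpsNumerator M ρ W V p τ = mpsVector (bracket ρ W V) M p τ := by
  rw [mpsNumerator, mpsVector, bracket_apply, word, List.map_map]
  rfl

/-- The fused relations are used at `x = κ`, `y = κ⁻¹`, of ratio `κ ^ 2`, and at `u = κ` and `u =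
κ⁻¹` for the two boundaries. All parameters are real, so the complex algebra is used as a real one.
-/
theorem isAnsatz_ansatzM {I : ℕ} {q κ a b c d : ℝ} (hq0 : 0 < q) (hq1 : q < 1)
    (hκ0 : 0 < κ) (hκ : κ < q ^ (((I : ℝ) - 1) / 2))
    (hc : 0 < c) (hd : 0 < d)
    (hac : q ^ ((1 - (I : ℝ)) / 2) / κ < a - c)
    (hbd : q ^ ((1 - (I : ℝ)) / 2) / κ < b - d)
    {H : Type*} [AddCommGroup H] [Module ℂ H]
    (ρ : A →ₐ[ℂ] Module.End ℂ H) (dOp eOp : A) (W : Module.Dual ℂ H) (V : H)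
    (hde : dOp * eOp - (q : ℂ) • (eOp * dOp) = algebraMap ℂ A (1 - (q : ℂ)))
    (hW : ∀ h : H, W (ρ ((a : ℂ) • eOp - (c : ℂ) • dOp + 1) h) = 0)
    (hV : ρ ((b : ℂ) • dOp - (d : ℂ) • eOp + 1) V = 0) :
    IsAnsatz (fusedWeights I q κ a b c d) (bracket ρ W V) (ansatzM I q κ dOp eOp) := by
  have hde' : dOp * eOp - q • (eOp * dOp) = algebraMap ℝ A (1 - q) := by
    rw [IsScalarTower.algebraMap_apply ℝ ℂ A, ← Complex.coe_smul, hde]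
    simp
  have hpos := fun i : Fin I => bdry_pos hq0 hκ0 i
  have hlt := fun i : Fin I => bdry_lt_one hq0 hq1 hκ0 hκ i
  have hprod : ∀ i j : Fin I, 1 - q * (bdry q κ j * bdry q κ i) ≠ 0 := fun i j => by
    have h1 := mul_lt_one_of_nonneg_of_lt_one_left (hpos j).le (hlt j) (hlt i).le
    have h2 := mul_pos (hpos j) (hpos i)
    nlinarith
  refine ⟨fun o => ?_, fun o x => ?_, fun o x => ?_⟩
  -- The swap accounts for the order of outputs: `fusedR` lists the horizontal one first, the vertex
  -- weight the vertical one.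
  · have h := fusedLetter_exchange (I := I) hq0 hde' hκ0.ne' (inv_ne_zero hκ0.ne') (fun i j => by
      rw [div_inv_eq_mul, ← pow_two, sq_mul_rpow_eq hq0]
      exact hprod _ _) o.swap
    rw [div_inv_eq_mul, ← pow_two] at h
    simp only [ansatzM_eq]
    exact h
  -- The rest `x` of the word is absorbed into the functional; at the right boundary this is done
  -- with left multiplication.
  · have h := fusedLetter_left_boundary (I := I) (bracket ρ W V ∘ₗ LinearMap.mulRight ℝ x)
      (a := a) (c := c) hq0 hde' (fun y => by
        rw [LinearMap.comp_apply, LinearMap.mulRight_apply, bracket_apply, mul_assoc, map_mul,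
          ← Complex.coe_smul, ← Complex.coe_smul]
        exact hW _) hκ0.ne'
      (fun i => by
        have h1 := inv_bdry_lt hq0 hq1 hκ0 hac i
        have h2 := (one_lt_inv₀ (hpos i)).2 (hlt i)
        have h3 := mul_le_of_le_one_right hc.le (pow_le_one₀ (n := 2) (hpos i).le (hlt i).le)
        have h4 := hlt i
        refine ne_of_lt ?_
        linarith)
      (fun i j _ => hprod i j) o
    simp only [LinearMap.comp_apply, LinearMap.mulRight_apply] at h
    simp only [ansatzM_eq, Finset.sum_mul, map_sum, smul_mul_assoc, map_smul]
    exact h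
  · have h := fusedLetter_right_boundary (I := I) (bracket ρ W V ∘ₗ LinearMap.mulLeft ℝ x)
      (b := b) (d := d) hq0 hde' (fun y => by
        rw [LinearMap.comp_apply, LinearMap.mulLeft_apply, bracket_apply, ← mul_assoc, map_mul,
          ← Complex.coe_smul, ← Complex.coe_smul, Module.End.mul_apply, hV, map_zero, map_zero])
      (inv_ne_zero hκ0.ne')
      (fun i => by
        have h1 := inv_bdry_lt hq0 hq1 hκ0 hbd i.rev
        have h2 := (one_lt_inv₀ (hpos i.rev)).2 (hlt i.rev)
        rw [← bdry_inv_eq hq0] at h1 h2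
        refine ne_of_gt ?_
        nlinarith [mul_pos (sub_pos.2 h1) (sub_pos.2 h2), mul_pos hd (sub_pos.2 h2)])
      (fun i j hij => one_sub_mul_bdry_inv_ne_zero hq0 hq1 hκ0 hκ hij.ne)
      (fun i j _ => by
        rw [bdry_inv_eq hq0, bdry_inv_eq hq0, ← mul_inv, inv_inv]
        exact hprod _ _) o
    simp only [LinearMap.comp_apply, LinearMap.mulLeft_apply, inv_inv] at h
    simp only [ansatzM_eq, Finset.mul_sum, map_sum, mul_smul_comm, map_smul, fusedWeights, one_div]
    exact h

end MatrixProduct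

end FusedVertex

end

/-! ### The main theorem -/

theorem mainTheorem3 (I N : ℕ) (hI : 1 ≤ I) (hN : 1 ≤ N)
    (q κ a b c d : ℝ) (hq0 : 0 < q) (hq1 : q < 1)
    (hκ0 : 0 < κ) (hκ : κ < q ^ (((I : ℝ) - 1) / 2))
    (ha : 0 < a) (hb : 0 < b) (hc : 0 < c) (hd : 0 < d)
    (hac : q ^ ((1 - (I : ℝ)) / 2) / κ < a - c)
    (hbd : q ^ ((1 - (I : ℝ)) / 2) / κ < b - d)
    {A : Type*} [Ring A] [Algebra ℂ A] {H : Type*} [AddCommGroup H] [Module ℂ H]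
    (ρ : A →ₐ[ℂ] Module.End ℂ H) (dOp eOp : A) (W : Module.Dual ℂ H) (V : H)
    (hde : dOp * eOp - (q : ℂ) • (eOp * dOp) = algebraMap ℂ A (1 - (q : ℂ)))
    (hW : ∀ h : H, W (ρ ((a : ℂ) • eOp - (c : ℂ) • dOp + 1) h) = 0)
    (hV : ρ ((b : ℂ) • dOp - (d : ℂ) • eOp + 1) V = 0) :
    (FusedVertex.fusedWeights I q κ a b c d).IsStochastic ∧
    ∀ P : FusedVertex.DownRightPath N,
      FusedVertex.transition (FusedVertex.fusedWeights I q κ a b c d) P P.shift ∈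
        Matrix.rowStochastic ℝ (Fin N → Fin (I + 1)) ∧
      (FusedVertex.mpsDenominator (FusedVertex.ansatzM I q κ dOp eOp) ρ W V P.dir ≠ 0 →
        ∃ μ : (Fin N → Fin (I + 1)) → ℝ,
          (∀ τ, (μ τ : ℂ) =
            FusedVertex.mpsNumerator (FusedVertex.ansatzM I q κ dOp eOp) ρ W V P.dir τ /
              FusedVertex.mpsDenominator (FusedVertex.ansatzM I q κ dOp eOp) ρ W V P.dir) ∧
          FusedVertex.IsStationaryMeasure
            (FusedVertex.transition (FusedVertex.fusedWeights I q κ a b c d) P P.shift) μ ∧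
          ∀ ν, FusedVertex.IsStationaryMeasure
            (FusedVertex.transition (FusedVertex.fusedWeights I q κ a b c d) P P.shift) ν → ν = μ) := by
  obtain ⟨hs, hm⟩ :=
    FusedVertex.fusedWeights_isStochastic_movesOn hq0 hq1 hκ0 hκ ha hb hc hd hac hbd
  have hM := FusedVertex.isAnsatz_ansatzM hq0 hq1 hκ0 hκ hc hd hac hbd ρ dOp eOp W V hde hW hV
  refine ⟨hs, fun P => ⟨?_, fun hZ => ?_⟩⟩
  · rw [Matrix.mem_rowStochastic_iff_sum]
    exact ⟨FusedVertex.transition_nonneg hs hN P, FusedVertex.sum_transition hs hN P⟩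
  -- Expanding the product of sums shows that the denominator is the sum of all numerators, the
  -- normalization required by `exists_unique_stationary`.
  · have hden : FusedVertex.mpsDenominator (FusedVertex.ansatzM I q κ dOp eOp) ρ W V P.dir =
        ∑ τ, FusedVertex.mpsVector (FusedVertex.bracket ρ W V)
          (FusedVertex.ansatzM I q κ dOp eOp) P.dir τ :=
      (FusedVertex.sum_mpsVector (FusedVertex.bracket ρ W V)
        (FusedVertex.ansatzM I q κ dOp eOp) P.dir).symm
    rw [hden] at hZ ⊢
    simp only [FusedVertex.mpsNumerator_eq]
    exact FusedVertex.exists_unique_stationary (FusedVertex.transition_nonneg hs hN P)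
      (FusedVertex.sum_transition hs hN P) (fun _ => 0) (FusedVertex.exitSum P.height)
      (FusedVertex.exists_transition_pos hs hm hN P)
      (FusedVertex.transition_mpsVector hM hN P) hZ
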